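/- **Setting.** All Hilbert spaces are finite-dimensional and nonzero. Let $P$ be a finite set of parties containing two distinct parties $a$ (the sender, Alice) and $b$ (the receiver, Bob); a multipartite system assigns to each party a Hilbert space. Let $d\ge 1$ be the dimension of the message system. A quantum channel is a completely positive trace-preserving map. *Processes.* A multi-round (non-Markovian) process $\mathcal E=\mathcal E_k\circ\cdots\circ\mathcal E_1$ is a finite sequence of quantum channels, where $\mathcal E_i$ maps a multipartite input system $I_i$ together with an internal memory $m_{i-1}$ to a multipartite output system $O_i$ together with an internal memory $m_i$; the initial memory $m_0$ is trivial, the memory is not accessible to the parties, and what is left in $m_k$ is discarded. *Free operations.* For $c\in\mathbb N$, let $\mathrm{LOCC}_1^{c}$ be the set of maps $\sum_{m=1}^{M}\bigotimes_{q\in P}\Phi_{m,q}$ between multipartite systems, where $M\le 2^{c}$, the $(\Phi_{m,a})_m$ are completely positive maps with trace-preserving sum (Alice's instrument, whose outcome $m$ is announced), and $\Phi_{m,q}$ is a quantum channel for every party $q\ne a$ and every $m$. Let $p$ be a polynomial with coefficients in $\mathbb N$ such that $d^2\le 2^{p(d)}$, and put $\mathrm{LOCC}_1(\mathrm{poly}(d)):=\mathrm{LOCC}_1^{p(d)}$.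 Let $\mathcal S$ be any set of quantum channels between multipartite systems that contains $\mathrm{LOCC}_1(\mathrm{poly}(d))$ (neither convexity nor closedness is assumed). *Free manipulations.* An $\mathcal S$-free manipulation $\Theta$ of a process with given round types $(I_i,O_i)_{i\le k}$ is a finite sequence of steps acting on the registers of the parties; each step either applies a channel of $\mathcal S$ to some registers of the parties, leaving all their other registers idle, or uses the next round of the process on some registers, again leaving the other ones idle; every round is used exactly once, in order. Running $\Theta$ together with $\mathcal E$ yields a map $\Theta(\mathcal E)$ from the initial to the final system of the parties. *Figures of merit.* Let $\phi^+_d$ be the projector onto $d^{-1/2}\sum_{i=1}^d|i\rangle_a|i\rangle_b$, and let $$F_{\max}^{d,\mathcal S}(\mathcal E):=\sup_{\Theta}\operatorname{Tr}\big[\Theta(\mathcal E)\,\phi^+_d\big],$$ the supremum being over all $\mathcal S$-free manipulations $\Theta$ with no (i.e. trivial) initial system whose final system consists of a $d$-dimensional system of $a$ and a $d$-dimensional system of $b$. Let $$f_{\max}(\mathcal E):=\sup_{\Theta} f(\Theta(\mathcal E)),\qquad f(\mathcal N):=\int d\psi\,\operatorname{Tr}[\psi\,\mathcal N(\psi)],$$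 the supremum being over all $\mathcal S$-free manipulations $\Theta$ whose initial system is a $d$-dimensional message system of $a$ and whose final system is a $d$-dimensional system of $b$; here $\psi=U|0\rangle\langle 0|U^\dagger$ with $U\in U(d)$ distributed according to the Haar probability measure, and both systems are identified with $\mathbb C^d$. **Theorem.** In both optimizations the set of admissible $\Theta$ is nonempty, every $\Theta(\mathcal E)$ is a quantum channel (in the first case: a state), and the values are bounded above. Moreover $$f_{\max}(\mathcal E)=\frac{d\,F_{\max}^{d,\mathcal S}(\mathcal E)+1}{d+1},$$ and the supremum defining $f_{\max}(\mathcal E)$ is attained if and only if the one defining $F_{\max}^{d,\mathcal S}(\mathcal E)$ is attained. -/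

import Mathlib

open MeasureTheory
open scoped BigOperators ComplexOrder

noncomputable section

namespace QuantumNetwork

/-! ### Quantum channels on finite-dimensional systems -/

/-- Linear maps from operators on `ℂ^ι` to operators on `ℂ^κ`. -/
abbrev OpMap (ι κ : Type) : Type :=
  Matrix ι ι ℂ →ₗ[ℂ] Matrix κ κ ℂ

/-- The map `Φ ⊗ id_μ`: `Φ` acts on the first tensor factor, the second one stays idle. -/
def ampliate {ι κ : Type} (Φ : OpMap ι κ) (μ : Type) : OpMap (ι × μ) (κ × μ) where
  toFun ρ := Matrix.of fun x y =>
    Φ (Matrix.of fun i j => ρ (i, x.2) (j, y.2)) x.1 y.1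
  map_add' ρ σ := by
    ext x y
    exact congrFun (congrFun (map_add Φ (Matrix.of fun i j => ρ (i, x.2) (j, y.2))
      (Matrix.of fun i j => σ (i, x.2) (j, y.2))) x.1) y.1
  map_smul' c ρ := by
    ext x y
    exact congrFun (congrFun (map_smul Φ c (Matrix.of fun i j => ρ (i, x.2) (j, y.2))) x.1) y.1

/-- Complete positivity: `Φ ⊗ id_n` preserves positive semidefiniteness for every `n`. -/
def IsCompletelyPositive {ι κ : Type} (Φ : OpMap ι κ) : Prop :=
  ∀ (n : ℕ) (ρ : Matrix (ι × Fin n) (ι × Fin n) ℂ),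
    ρ.PosSemidef → (ampliate Φ (Fin n) ρ).PosSemidef

/-- Trace preservation. -/
def IsTracePreserving {ι κ : Type} [Fintype ι] [Fintype κ] (Φ : OpMap ι κ) : Prop :=
  ∀ ρ : Matrix ι ι ℂ, (Φ ρ).trace = ρ.trace

/-- A quantum channel is a completely positive trace-preserving map. -/
structure IsChannel {ι κ : Type} [Fintype ι] [Fintype κ] (Φ : OpMap ι κ) : Prop where
  completelyPositive : IsCompletelyPositive Φ
  tracePreserving : IsTracePreserving Φ

/-- The relabelling of basis vectors along a bijection, as a map on operators. -/
def relabel {ι κ : Type} (e : ι ≃ κ) : OpMap ι κ :=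
  (Matrix.reindexLinearEquiv ℂ ℂ e e).toLinearMap

/-- The partial trace over the second tensor factor. -/
def traceOutRight (ι μ : Type) [Fintype μ] : OpMap (ι × μ) ι where
  toFun ρ := Matrix.of fun i j => ∑ x : μ, ρ (i, x) (j, x)
  map_add' ρ σ := by
    ext i j
    simp [Finset.sum_add_distrib]
  map_smul' c ρ := by
    ext i j
    simp [Finset.mul_sum]

/-- Adjoining a one-dimensional tensor factor. -/
def adjoinTrivial (ι : Type) : OpMap ι (ι × Fin ((1 : ℕ+) : ℕ)) where
  toFun ρ := Matrix.of fun x y => ρ x.1 y.1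
  map_add' _ _ := rfl
  map_smul' _ _ := rfl

/-! ### Multipartite systems -/

/-- A system distributed among the parties `P`: party `q` holds a Hilbert space `ℂ^(X q)` of
positive finite dimension (dimension one meaning that `q` holds nothing). -/
abbrev System (P : Type) : Type := P → ℕ+

/-- The product basis of the total Hilbert space of a multipartite system. -/
abbrev Idx {P : Type} (X : System P) : Type := ∀ q : P, Fin (X q)

/-- Linear maps from operators on the system `X` to operators on the system `Y`. -/
abbrev Op {P : Type} (X Y : System P) : Type := OpMap (Idx X) (Idx Y)

/-- The system in which nobody holds anything. -/
def trivialSystem {P : Type} : System P := fun _ => 1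

/-- A `d`-dimensional system in the hands of the party `a`. -/
def solo {P : Type} [DecidableEq P] (a : P) (d : ℕ+) : System P := fun q => if q = a then d else 1

/-- A pair of `d`-dimensional systems, one in the hands of `a` and one in the hands of `b`
(used for `a ≠ b`). -/
def pair {P : Type} [DecidableEq P] (a b : P) (d : ℕ+) : System P := fun q => if q = a ∨ q = b then d else 1

lemma solo_self {P : Type} [DecidableEq P] (a : P) (d : ℕ+) : ((solo a d a : ℕ+) : ℕ) = d := by simp [solo]

lemma pair_left {P : Type} [DecidableEq P] (a b : P) (d : ℕ+) : ((pair a b d a : ℕ+) : ℕ) = d := by simp [pair]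

lemma pair_right {P : Type} [DecidableEq P] (a b : P) (d : ℕ+) : ((pair a b d b : ℕ+) : ℕ) = d := by simp [pair]

/-- The standard identification of the Hilbert space of `solo a d` with `ℂ^d`. -/
def soloEquiv {P : Type} [DecidableEq P] (a : P) (d : ℕ+) : Idx (solo a d) ≃ Fin d where
  toFun x := Fin.cast (solo_self a d) (x a)
  invFun i := fun q =>
    if h : q = a then Fin.cast (by subst h; exact (solo_self q d).symm) i else 0
  left_inv x := by
    funext q
    by_cases h : q = a
    · subst h
      simp
    · have h1 : ((solo a d q : ℕ+) : ℕ) = 1 := by simp [solo, h]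
      apply Fin.ext
      have := (x q).isLt
      simp only [h, dite_false]
      have h0 : ((0 : Fin (solo a d q)) : ℕ) = 0 := Fin.val_zero _
      omega
  right_inv i := by simp

/-- The product of local linear maps, `⊗_q Φ_q`, on a multipartite system. -/
def localProduct {P : Type} [Fintype P] [DecidableEq P] {X Y : System P} (Φ : ∀ q : P, OpMap (Fin (X q)) (Fin (Y q))) : Op X Y where
  toFun ρ := ∑ i : Idx X, ∑ j : Idx X, ρ i j •
    Matrix.of fun k l => ∏ q : P, Φ q (Matrix.single (i q) (j q) 1) (k q) (l q)
  map_add' ρ σ := by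
    simp only [Matrix.add_apply, add_smul, Finset.sum_add_distrib]
  map_smul' c ρ := by
    simp only [Matrix.smul_apply, smul_eq_mul, mul_smul, Finset.smul_sum, RingHom.id_apply]

/-- One-way LOCC from the party `a`, with at most `c` bits of communication, followed by
coarse-graining: `a` applies a quantum instrument `(Φ m a)_m` and announces the outcome `m`, one of
at most `2 ^ c` messages, to the other parties; conditionally on `m` every other party `q` applies a
channel `Φ m q`; the outcome is then forgotten. -/
def LOCC₁ {P : Type} [Fintype P] [DecidableEq P] (a : P) (c : ℕ) (X Y : System P) : Set (Op X Y) :=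
  {Λ | ∃ M : ℕ, M ≤ 2 ^ c ∧
    ∃ Φ : Fin M → ∀ q : P, OpMap (Fin (X q)) (Fin (Y q)),
      (∀ m, IsCompletelyPositive (Φ m a)) ∧
      IsTracePreserving (∑ m, Φ m a) ∧
      (∀ m q, q ≠ a → IsChannel (Φ m q)) ∧
      Λ = ∑ m, localProduct (Φ m)}

/-! ### Multi-round processes and their free manipulations -/

/-- `NetworkProcess L m` is what remains of a multi-round process while its internal memory is `ℂ^m`:
`L` lists the (input, output) pairs of multipartite systems of the rounds to come, and the channel
of each round acts jointly on the input of that round and on the memory. The memory is not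
accessible from outside; what is left in it after the last round is discarded. -/
inductive NetworkProcess (P : Type) [Fintype P] [DecidableEq P] : List (System P × System P) → ℕ+ → Type
  | nil {m : ℕ+} : NetworkProcess P [] m
  | cons {I O : System P} {L : List (System P × System P)} {m m' : ℕ+}
      (E : OpMap (Idx I × Fin m) (Idx O × Fin m')) (hE : IsChannel E)
      (rest : NetworkProcess P L m') : NetworkProcess P ((I, O) :: L) m

/-- A choice of a set of maps between any two multipartite systems. -/
abbrev OpClass (P : Type) : Type := ∀ X Y : System P, Set (Op X Y)

/-- Every party `q` views its space `W q` as a pair of registers `X q ⊗ M q`. -/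
abbrev Split {P : Type} (W X M : System P) : Type := ∀ q : P, Fin (W q) ≃ Fin (X q) × Fin (M q)

/-- A split of all local spaces is a split of the total space. -/
def Split.total {P : Type} {W X M : System P} (e : Split W X M) : Idx W ≃ Idx X × Idx M :=
  (Equiv.piCongrRight e).trans (Equiv.arrowProdEquivProdArrow P _ _)

/-- `Manipulation S L W Y` is the type of `S`-free manipulations of processes with rounds `L` which
start with the system `W` and end with the system `Y`. Such a manipulation is a finite sequence of
steps. In a step either a channel of `S` is applied to some registers `X` of the parties, producing
`X'`, or the next round of the process is used, with registers `I` as its input, producing `O`; all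
other registers `M` of the parties stay idle (they are the memory of the manipulation). -/
inductive Manipulation {P : Type} (S : OpClass P) :
    List (System P × System P) → System P → System P → Type
  | done (Y : System P) : Manipulation S [] Y Y
  | free {L : List (System P × System P)} {W W' Y X X' M : System P}
      (e : Split W X M) (e' : Split W' X' M) (Λ : Op X X') (hΛ : Λ ∈ S X X')
      (rest : Manipulation S L W' Y) : Manipulation S L W Y
  | use {I O : System P} {L : List (System P × System P)} {W W' Y M : System P}
      (e : Split W I M) (e' : Split W' O M)
      (rest : Manipulation S L W' Y) : Manipulation S ((I, O) :: L) W Y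

/-- The registers `X` are separated from the idle registers `M` and the process memory. -/
def regroupFree {P : Type} {W X M : System P} (e : Split W X M) (m : ℕ+) :
    Idx W × Fin m ≃ Idx X × (Idx M × Fin m) :=
  (Equiv.prodCongr e.total (Equiv.refl _)).trans (Equiv.prodAssoc _ _ _)

/-- The registers `X` and the process memory are separated from the idle registers `M`. -/
def regroupUse {P : Type} {W X M : System P} (e : Split W X M) (m : ℕ+) :
    Idx W × Fin m ≃ (Idx X × Fin m) × Idx M :=
  ((regroupFree e m).trans (Equiv.prodCongr (Equiv.refl _) (Equiv.prodComm _ _))).trans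
    (Equiv.prodAssoc _ _ _).symm

/-- The map implemented by running a manipulation together with a process, on the parties' system
and the internal memory of the process. -/
def Manipulation.run {P : Type} [Fintype P] [DecidableEq P] {S : OpClass P} : {L : List (System P × System P)} → {W Y : System P} →
    Manipulation S L W Y → {m : ℕ+} → NetworkProcess P L m → OpMap (Idx W × Fin m) (Idx Y)
  | _, _, _, .done Y, m, .nil => traceOutRight (Idx Y) (Fin m)
  | _, _, _, .free (M := M) e e' Λ _ rest, m, E =>
      rest.run E ∘ₗ relabel (regroupFree e' m).symm ∘ₗ ampliate Λ (Idx M × Fin m) ∘ₗ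
        relabel (regroupFree e m)
  | _, _, _, .use (M := M) e e' rest, m, .cons (m' := m') E _ E' =>
      rest.run E' ∘ₗ relabel (regroupUse e' m').symm ∘ₗ ampliate E (Idx M) ∘ₗ
        relabel (regroupUse e m)

/-- The map `Θ(E)` obtained from the process `E` by the manipulation `Θ`. -/
def Manipulation.apply {P : Type} [Fintype P] [DecidableEq P] {S : OpClass P} {L : List (System P × System P)} {W Y : System P}
    (Θ : Manipulation S L W Y) (E : NetworkProcess P L 1) : Op W Y :=
  Θ.run E ∘ₗ adjoinTrivial (Idx W)

/-! ### Distillation fidelity -/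

/-- The density matrix `φ⁺_d` of the maximally entangled state `d^{-1/2} ∑ᵢ |i⟩_a |i⟩_b`. -/
def maxEntangled {P : Type} [DecidableEq P] (a b : P) (d : ℕ+) : Matrix (Idx (pair a b d)) (Idx (pair a b d)) ℂ :=
  Matrix.of fun x y =>
    if (x a : ℕ) = (x b : ℕ) ∧ (y a : ℕ) = (y b : ℕ) then (1 / (d : ℂ)) else 0

/-- The overlap `Tr[Θ(E) φ⁺_d]` of the state `Θ(E)` (a channel without input) with `φ⁺_d`. -/
def distillationFidelity {P : Type} [Fintype P] [DecidableEq P] {a b : P} {d : ℕ+} (ρ : Op trivialSystem (pair a b d)) : ℝ :=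
  ((ρ 1 * maxEntangled a b d).trace).re

/-- The `d`-fidelity of `S` distillation `F_max^{d,S}(E)`. -/
def FMax {P : Type} [Fintype P] [DecidableEq P] (S : OpClass P) (a b : P) (d : ℕ+) {L : List (System P × System P)}
    (E : NetworkProcess P L 1) : ℝ :=
  ⨆ Θ : Manipulation S L trivialSystem (pair a b d), distillationFidelity (Θ.apply E)

/-! ### Average fidelity -/

/-- The unitary group `U(d)`. -/
abbrev UGroup (d : ℕ+) : Type := Matrix.unitaryGroup (Fin d) ℂ

instance instCompactSpaceUGroup (d : ℕ+) : CompactSpace (UGroup d) := by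
  refine isCompact_iff_compactSpace.mp ?_
  have hsub : ((Matrix.unitaryGroup (Fin d) ℂ : Submonoid _) : Set (Matrix (Fin d) (Fin d) ℂ)) ⊆
      Set.univ.pi fun _ => Set.univ.pi fun _ => Metric.closedBall (0 : ℂ) 1 := by
    intro U hU i _ j _
    simpa using entry_norm_bound_of_unitary hU i j
  have hK : IsCompact (Set.univ.pi fun _ : Fin d => Set.univ.pi fun _ : Fin d =>
      Metric.closedBall (0 : ℂ) 1) :=
    isCompact_univ_pi fun _ => isCompact_univ_pi fun _ => isCompact_closedBall 0 1
  exact hK.of_isClosed_subset (isClosed_unitary (R := Matrix (Fin d) (Fin d) ℂ)) hsub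

instance instMeasurableSpaceUGroup (d : ℕ+) : MeasurableSpace (UGroup d) := borel _

instance instBorelSpaceUGroup (d : ℕ+) : BorelSpace (UGroup d) := ⟨rfl⟩

/-- The Haar probability measure on `U(d)`. -/
def haarU (d : ℕ+) : Measure (UGroup d) := Measure.haarMeasure ⊤

/-- The Haar random pure state `ψ = U|0⟩⟨0|U†`. -/
def pureState {d : ℕ+} (U : UGroup d) : Matrix (Fin d) (Fin d) ℂ :=
  (U : Matrix (Fin d) (Fin d) ℂ) * Matrix.single 0 0 1 *
    (U : Matrix (Fin d) (Fin d) ℂ).conjTranspose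

/-- The average fidelity `f(N) = ∫ dψ Tr[ψ N(ψ)]` of a channel `N` from a `d`-dimensional system
of `a` to a `d`-dimensional system of `b`. -/
def averageFidelity {P : Type} [Fintype P] [DecidableEq P] {a b : P} {d : ℕ+} (N : Op (solo a d) (solo b d)) : ℝ :=
  ∫ U : UGroup d, ((relabel (soloEquiv b d).symm (pureState U) *
    N (relabel (soloEquiv a d).symm (pureState U))).trace).re ∂(haarU d)

/-- The optimal performance `f_max(E)` over all `S`-free manipulations. -/
def fMax {P : Type} [Fintype P] [DecidableEq P] (S : OpClass P) (a b : P) (d : ℕ+) {L : List (System P × System P)}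
    (E : NetworkProcess P L 1) : ℝ :=
  ⨆ Θ : Manipulation S L (solo a d) (solo b d), averageFidelity (Θ.apply E)

end QuantumNetwork

end

open QuantumNetwork

/-! The average fidelity of a trace-preserving map `N` is an affine function of its entanglement
fidelity: `f(N) = (d F(N) + 1) / (d + 1)` (`averageFidelity_eq`). This follows from the fourth
moments of a Haar random unit vector (`moment_eq`), which are determined by invariance under
diagonal phases, which leaves only the matched moments, and under one unitary mixing two basis
vectors (`moment_mix`), which gives `∫ |uᵢ|⁴ = 2 ∫ |uᵢ|² |uₖ|²`, together with normalization.

It therefore suffices to convert the two kinds of manipulations into each other while matching the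
two fidelities.
* Given a manipulation `Θ` that transmits a message, the sender prepares a maximally entangled pair
  locally and sends half of it through `Θ`, the other half staying idle. The overlap of the result
  with `φ⁺` is the entanglement fidelity of `Θ(E)` (`trace_distilled`, `exists_distillation`).
* Given a manipulation that distils a state, the message stays idle while the state is produced and
  is then teleported through it, with `d ^ 2` outcomes labelled by the Weyl operators. The resulting
  channel has the overlap with `φ⁺` as its entanglement fidelity (`entanglementSum_teleport`,
  `exists_transmission`).

Both conversions have the form `Manipulation.sandwich`: a local operation, then the given
manipulation on one of two registers, then another local operation. Its action is computed in
`Manipulation.sandwich_apply`. The two families of values then correspond under the increasing map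
`x ↦ (d x + 1) / (d + 1)`, which gives the equality of the suprema and the equivalence of
attainment (`iSup_affine`). -/

noncomputable section

namespace QuantumNetwork

/-! ### Completely positive maps -/

section Channels

variable {ι κ μ ν τ : Type}

lemma ampliate_apply (Φ : OpMap ι κ) (ρ : Matrix (ι × μ) (ι × μ) ℂ) (x y : κ × μ) :
    ampliate Φ μ ρ x y = Φ (Matrix.of fun i j => ρ (i, x.2) (j, y.2)) x.1 y.1 := rfl

lemma relabel_apply (e : ι ≃ κ) (ρ : Matrix ι ι ℂ) (x y : κ) :
    relabel e ρ x y = ρ (e.symm x) (e.symm y) := rfl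

lemma relabel_posSemidef (e : ι ≃ κ) {ρ : Matrix ι ι ℂ} (h : ρ.PosSemidef) :
    (relabel e ρ).PosSemidef := h.submatrix e.symm

/-- In the definition of complete positivity the idle system may be indexed by any finite type. -/
lemma IsCompletelyPositive.ampliate_posSemidef [Fintype μ] {Φ : OpMap ι κ}
    (h : IsCompletelyPositive Φ) {ρ : Matrix (ι × μ) (ι × μ) ℂ} (hρ : ρ.PosSemidef) :
    (ampliate Φ μ ρ).PosSemidef := by
  have e := Fintype.equivFin μ
  have h1 := h _ _ (hρ.submatrix (Prod.map (id : ι → ι) e.symm))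
  have h2 := h1.submatrix (Prod.map (id : κ → κ) e)
  convert h2 using 1
  ext x y
  simp [ampliate_apply]

lemma IsCompletelyPositive.comp {Ψ : OpMap κ τ} {Φ : OpMap ι κ} (hΨ : IsCompletelyPositive Ψ)
    (hΦ : IsCompletelyPositive Φ) : IsCompletelyPositive (Ψ ∘ₗ Φ) :=
  fun n _ hρ => hΨ n _ (hΦ n _ hρ)

lemma IsCompletelyPositive.ampliate [Fintype μ] {Φ : OpMap ι κ} (h : IsCompletelyPositive Φ) :
    IsCompletelyPositive (ampliate Φ μ) := by
  intro n ρ hρ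
  have h1 := h.ampliate_posSemidef (relabel_posSemidef (Equiv.prodAssoc ι μ (Fin n)) hρ)
  exact relabel_posSemidef (Equiv.prodAssoc κ μ (Fin n)).symm h1

lemma isCompletelyPositive_relabel (e : ι ≃ κ) : IsCompletelyPositive (relabel e) := fun n _ hρ =>
  relabel_posSemidef (Equiv.prodCongr e (Equiv.refl (Fin n))) hρ

lemma isCompletelyPositive_sum {s : Finset τ} {Φ : τ → OpMap ι κ}
    (h : ∀ t ∈ s, IsCompletelyPositive (Φ t)) : IsCompletelyPositive (∑ t ∈ s, Φ t) := by
  intro n ρ hρ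
  have h1 : QuantumNetwork.ampliate (∑ t ∈ s, Φ t) (Fin n) ρ =
      ∑ t ∈ s, QuantumNetwork.ampliate (Φ t) (Fin n) ρ := by
    ext x y
    simp [ampliate_apply, Matrix.sum_apply]
  rw [h1]
  exact Matrix.posSemidef_sum s fun t ht => h t ht n ρ hρ

/-- The completely positive map `X ↦ K X K†` with a single Kraus operator `K`. -/
def krausMap [Fintype ι] (K : Matrix κ ι ℂ) : OpMap ι κ where
  toFun ρ := K * ρ * K.conjTranspose
  map_add' ρ σ := by rw [Matrix.mul_add, Matrix.add_mul]
  map_smul' c ρ := by simp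

lemma krausMap_def [Fintype ι] (K : Matrix κ ι ℂ) (ρ : Matrix ι ι ℂ) :
    krausMap K ρ = K * ρ * K.conjTranspose := rfl

lemma krausMap_apply [Fintype ι] (K : Matrix κ ι ℂ) (ρ : Matrix ι ι ℂ) (k l : κ) :
    krausMap K ρ k l = ∑ i, ∑ j, K k i * ρ i j * star (K l j) := by
  rw [krausMap_def, Matrix.mul_apply, Finset.sum_comm]
  simp [Matrix.mul_apply, Finset.sum_mul]

lemma isCompletelyPositive_krausMap [Fintype ι] [Fintype κ] (K : Matrix κ ι ℂ) :
    IsCompletelyPositive (krausMap K) := by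
  classical
  intro n ρ hρ
  have h1 : ampliate (krausMap K) (Fin n) ρ =
      (Matrix.kroneckerMap (· * ·) K (1 : Matrix (Fin n) (Fin n) ℂ)) * ρ *
        (Matrix.kroneckerMap (· * ·) K (1 : Matrix (Fin n) (Fin n) ℂ)).conjTranspose := by
    ext x y
    rw [ampliate_apply, krausMap_apply, Matrix.mul_apply, Fintype.sum_prod_type, Finset.sum_comm]
    simp [Matrix.mul_apply, Fintype.sum_prod_type, Finset.sum_mul, Matrix.one_apply,
      Finset.sum_ite_eq, apply_ite]
  rw [h1]
  exact hρ.mul_mul_conjTranspose_same _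

/-- A family of Kraus operators with `∑ K† K = 1` preserves the trace. -/
lemma isTracePreserving_sum_krausMap [Fintype ι] [Fintype κ] [DecidableEq ι] {s : Finset τ}
    {K : τ → Matrix κ ι ℂ} (h : ∑ t ∈ s, (K t).conjTranspose * K t = 1) :
    IsTracePreserving (∑ t ∈ s, krausMap (K t)) := by
  intro ρ
  simp only [LinearMap.sum_apply, Matrix.trace_sum, krausMap_def]
  have h1 : ∀ t ∈ s, (K t * ρ * (K t).conjTranspose).trace =
      ((K t).conjTranspose * K t * ρ).trace := fun t _ => by
    rw [Matrix.trace_mul_comm, Matrix.mul_assoc]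
  rw [Finset.sum_congr rfl h1, ← Matrix.trace_sum, ← Finset.sum_mul, h, Matrix.one_mul]

lemma isChannel_sum_krausMap [Fintype ι] [Fintype κ] [DecidableEq ι] {s : Finset τ}
    {K : τ → Matrix κ ι ℂ} (h : ∑ t ∈ s, (K t).conjTranspose * K t = 1) :
    IsChannel (∑ t ∈ s, krausMap (K t)) :=
  ⟨isCompletelyPositive_sum fun _ _ => isCompletelyPositive_krausMap _,
    isTracePreserving_sum_krausMap h⟩

lemma isChannel_krausMap [Fintype ι] [Fintype κ] [DecidableEq ι] {K : Matrix κ ι ℂ}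
    (h : K.conjTranspose * K = 1) : IsChannel (krausMap K) := by
  simpa using isChannel_sum_krausMap (s := {()}) (K := fun _ => K) (by simpa using h)

lemma IsChannel.comp [Fintype ι] [Fintype κ] [Fintype τ] {Ψ : OpMap κ τ} {Φ : OpMap ι κ}
    (hΨ : IsChannel Ψ) (hΦ : IsChannel Φ) : IsChannel (Ψ ∘ₗ Φ) :=
  ⟨hΨ.1.comp hΦ.1, fun ρ => (hΨ.2 _).trans (hΦ.2 ρ)⟩

lemma isChannel_relabel [Fintype ι] [Fintype κ] (e : ι ≃ κ) : IsChannel (relabel e) :=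
  ⟨isCompletelyPositive_relabel e, fun ρ => by
    simpa [Matrix.trace, relabel_apply] using Equiv.sum_comp e.symm fun i => ρ i i⟩

lemma IsChannel.ampliate [Fintype ι] [Fintype κ] [Fintype μ] {Φ : OpMap ι κ} (h : IsChannel Φ) :
    IsChannel (ampliate Φ μ) := by
  refine ⟨h.1.ampliate, fun ρ => ?_⟩
  simp only [Matrix.trace, Matrix.diag_apply, ampliate_apply, Fintype.sum_prod_type]
  rw [Finset.sum_comm, Finset.sum_comm (γ := ι)]
  exact Finset.sum_congr rfl fun x _ => h.2 _

lemma isChannel_traceOutRight [Fintype ι] [Fintype μ] : IsChannel (traceOutRight ι μ) := by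
  refine ⟨fun n ρ hρ => ?_, fun ρ => ?_⟩
  · have h1 : QuantumNetwork.ampliate (traceOutRight ι μ) (Fin n) ρ =
        ∑ x : μ, ρ.submatrix (fun y : ι × Fin n => ((y.1, x), y.2))
          (fun y : ι × Fin n => ((y.1, x), y.2)) := by
      ext y z
      simp [ampliate_apply, traceOutRight, Matrix.sum_apply]
    rw [h1]
    exact Matrix.posSemidef_sum _ fun x _ => hρ.submatrix _
  · simp [Matrix.trace, traceOutRight, Fintype.sum_prod_type]

lemma isChannel_adjoinTrivial [Fintype ι] : IsChannel (adjoinTrivial ι) := by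
  refine ⟨fun n ρ hρ => ?_, fun ρ => ?_⟩
  · exact hρ.submatrix fun y : (ι × Fin ((1 : ℕ+) : ℕ)) × Fin n => (y.1.1, y.2)
  · rw [Matrix.trace, Fintype.sum_prod_type]
    change ∑ i, ∑ _x : Fin 1, ρ i i = _
    simp [Matrix.trace]

/-- The channel that discards its input and prepares the pure state `|k⟩⟨k|`. -/
def discardPrepare [Fintype ι] [DecidableEq ι] [DecidableEq κ] (k : κ) : OpMap ι κ :=
  ∑ i : ι, krausMap (Matrix.single k i 1)

lemma isChannel_discardPrepare [Fintype ι] [Fintype κ] [DecidableEq ι] [DecidableEq κ] (k : κ) :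
    IsChannel (discardPrepare k : OpMap ι κ) := by
  refine isChannel_sum_krausMap ?_
  simp only [Matrix.conjTranspose_single, Matrix.single_mul_single_same, star_one, mul_one]
  exact Matrix.sum_single_one

end Channels

/-! ### Products of local maps -/

section Local

variable {P : Type} [Fintype P]

/-- The tensor product `⊗_q K_q` of local matrices. -/
def prodMatrix {X Y : System P} (K : ∀ q, Matrix (Fin (Y q)) (Fin (X q)) ℂ) :
    Matrix (Idx Y) (Idx X) ℂ :=
  Matrix.of fun k i => ∏ q, K q (k q) (i q)

lemma prodMatrix_apply {X Y : System P} (K : ∀ q, Matrix (Fin (Y q)) (Fin (X q)) ℂ) (k : Idx Y)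
    (i : Idx X) : prodMatrix K k i = ∏ q, K q (k q) (i q) := rfl

variable [DecidableEq P]

/-- A product of maps with one Kraus operator each has the product as its Kraus operator. -/
lemma localProduct_krausMap {X Y : System P} (K : ∀ q, Matrix (Fin (Y q)) (Fin (X q)) ℂ) :
    localProduct (fun q => krausMap (K q)) = krausMap (prodMatrix K) := by
  ext ρ k l
  simp [localProduct, krausMap_apply, Matrix.sum_apply, prodMatrix_apply, Matrix.single_apply,
    ite_and, Finset.prod_mul_distrib]
  exact Finset.sum_congr rfl fun _ _ => Finset.sum_congr rfl fun _ _ => by ring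

/-- A single round of local channels is a one-way LOCC operation. -/
lemma localProduct_mem_LOCC₁ (a : P) (c : ℕ) {X Y : System P}
    {Φ : ∀ q, OpMap (Fin (X q)) (Fin (Y q))} (h : ∀ q, IsChannel (Φ q)) :
    localProduct Φ ∈ LOCC₁ a c X Y :=
  ⟨1, Nat.one_le_two_pow, fun _ => Φ, fun _ => (h a).1, by simpa using (h a).2,
    fun _ q _ => h q, by simp⟩

lemma krausMap_prodMatrix_mem_LOCC₁ (a : P) (c : ℕ) {X Y : System P}
    {K : ∀ q, Matrix (Fin (Y q)) (Fin (X q)) ℂ} (h : ∀ q, (K q).conjTranspose * K q = 1) :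
    krausMap (prodMatrix K) ∈ LOCC₁ a c X Y := by
  rw [← localProduct_krausMap]
  exact localProduct_mem_LOCC₁ a c fun q => isChannel_krausMap (h q)

/-- The matrix that permutes the basis vectors along a bijection. -/
def permMatrix {ι κ : Type} [DecidableEq κ] (e : ι ≃ κ) : Matrix κ ι ℂ :=
  Matrix.of fun k i => if k = e i then 1 else 0

lemma permMatrix_isometry {ι κ : Type} [DecidableEq ι] [DecidableEq κ] [Fintype κ] (e : ι ≃ κ) :
    (permMatrix e).conjTranspose * permMatrix e = 1 := by
  ext i j
  simp [permMatrix, Matrix.mul_apply, Matrix.one_apply, eq_comm]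

lemma krausMap_prodMatrix_permMatrix {X Y : System P} (e : ∀ q, Fin (X q) ≃ Fin (Y q)) :
    krausMap (prodMatrix fun q => permMatrix (e q)) = relabel (Equiv.piCongrRight e) := by
  have h : ∀ k i, prodMatrix (fun q => permMatrix (e q)) k i =
      if i = (Equiv.piCongrRight e).symm k then 1 else 0 := by
    intro k i
    simp only [prodMatrix_apply, permMatrix, Matrix.of_apply, Finset.prod_ite_zero,
      Finset.prod_const_one, Finset.mem_univ, true_implies]
    refine if_congr ?_ rfl rfl
    rw [Equiv.eq_symm_apply, eq_comm, funext_iff]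
    rfl
  ext ρ k l
  simp [krausMap_apply, h, relabel_apply, apply_ite]

end Local

/-! ### Local action of a map on a split system -/

section LocalAction

variable {ι κ μ ν σ τ σ' τ' : Type}

/-- The map `Φ` acting on the first factor of a system `σ ≃ ι × μ`, with output in
`τ ≃ κ × μ`. -/
def localAction (Φ : OpMap ι κ) (f : σ ≃ ι × μ) (f' : τ ≃ κ × μ) : OpMap σ τ :=
  relabel f'.symm ∘ₗ ampliate Φ μ ∘ₗ relabel f

/-- A relabelling of the idle factor does not change a local action. -/
lemma localAction_trans_prodCongr (Φ : OpMap ι κ) (f : σ ≃ ι × ν) (f' : τ ≃ κ × ν) (h : ν ≃ μ) :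
    localAction Φ (f.trans (Equiv.prodCongr (Equiv.refl _) h))
      (f'.trans (Equiv.prodCongr (Equiv.refl _) h)) = localAction Φ f f' := by
  ext ρ x y
  simp [localAction, relabel_apply, ampliate_apply]

/-- A local action inside a local action is a local action with a larger idle factor. -/
lemma localAction_localAction (Φ : OpMap ι κ) (f : σ ≃ ι × μ) (f' : τ ≃ κ × μ) (g : σ' ≃ σ × ν)
    (g' : τ' ≃ τ × ν) :
    localAction (localAction Φ f f') g g' =
      localAction Φ ((g.trans (Equiv.prodCongr f (Equiv.refl ν))).trans (Equiv.prodAssoc _ _ _))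
        ((g'.trans (Equiv.prodCongr f' (Equiv.refl ν))).trans (Equiv.prodAssoc _ _ _)) := rfl

lemma relabel_comp_localAction (Φ : OpMap ι κ) (f : σ ≃ ι × μ) (f' : τ ≃ κ × μ) :
    relabel f' ∘ₗ localAction Φ f f' = ampliate Φ μ ∘ₗ relabel f := by
  ext ρ x y
  simp [localAction, relabel_apply]

lemma isChannel_localAction [Fintype ι] [Fintype κ] [Fintype μ] [Fintype σ] [Fintype τ]
    {Φ : OpMap ι κ} (h : IsChannel Φ) (f : σ ≃ ι × μ) (f' : τ ≃ κ × μ) :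
    IsChannel (localAction Φ f f') :=
  (isChannel_relabel _).comp (h.ampliate.comp (isChannel_relabel _))

end LocalAction

/-! ### Splits of local systems -/

section Splits

variable {P : Type}

/-- The party-wise tensor product `X * M` of two systems, viewed as a pair of registers. -/
def splitMul (X M : System P) : Split (X * M) X M := fun _ => finProdFinEquiv.symm

lemma splitMul_total_symm_apply (X M : System P) (x : Idx X) (y : Idx M) (q : P) :
    splitMul X M q ((splitMul X M).total.symm (x, y) q) = (x q, y q) :=
  (splitMul X M q).apply_symm_apply _

/-- The one-dimensional system as second register. -/
def splitTrivial (X : System P) : Split X X trivialSystem := fun _ =>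
  (Equiv.prodUnique (Fin _) (Fin 1)).symm

/-- Idle registers `N` are appended to the idle registers `M` of a split. -/
def Split.mulRight {P : Type} {W X M : System P} (e : Split W X M) (N : System P) :
    Split (W * N) X (M * N) := fun q =>
  (((splitMul W N q).trans (Equiv.prodCongr (e q) (Equiv.refl _))).trans
    (Equiv.prodAssoc _ _ _)).trans (Equiv.prodCongr (Equiv.refl _) (splitMul M N q).symm)

/-- The idle register `N` can be split off before or after the registers `X`. -/
lemma Split.total_splitMul_mulRight {W X M : System P} (e : Split W X M) (N : System P)
    (w : Idx (W * N)) : (splitMul M N).total ((e.mulRight N).total w).2 =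
      ((e.total ((splitMul W N).total w).1).2, ((splitMul W N).total w).2) := by
  have h : ∀ q, splitMul M N q (((e.mulRight N).total w).2 q) =
      ((e q (splitMul W N q (w q)).1).2, (splitMul W N q (w q)).2) := fun q =>
    (splitMul M N q).apply_symm_apply _
  exact Prod.ext (funext fun q => congrArg Prod.fst (h q)) (funext fun q => congrArg Prod.snd (h q))

/-- Two regroupings of registers, idle registers and process memory agree up to a regrouping of
the parts on which a channel of `S` does not act. -/
lemma regroupFree_mulRight {W X M : System P} (e : Split W X M) (N : System P) (m : ℕ+) :
    ((regroupUse (splitMul W N) m).trans (Equiv.prodCongr (regroupFree e m) (Equiv.refl _))).trans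
      (Equiv.prodAssoc _ _ _) = (regroupFree (e.mulRight N) m).trans
        (Equiv.prodCongr (Equiv.refl _) (regroupUse (splitMul M N) m)) := by
  ext1 ⟨w, x⟩
  have h := e.total_splitMul_mulRight N w
  exact Prod.ext rfl (Prod.ext (Prod.ext (congrArg Prod.fst h).symm rfl) (congrArg Prod.snd h).symm)

/-- Two regroupings of registers, idle registers and process memory agree up to a regrouping of
the parts on which a round of the process does not act. -/
lemma regroupUse_mulRight {W X M : System P} (e : Split W X M) (N : System P) (m : ℕ+) :
    ((regroupUse (splitMul W N) m).trans (Equiv.prodCongr (regroupUse e m) (Equiv.refl _))).trans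
      (Equiv.prodAssoc _ _ _) = (regroupUse (e.mulRight N) m).trans
        (Equiv.prodCongr (Equiv.refl _) (splitMul M N).total) := by
  ext1 ⟨w, x⟩
  exact Prod.ext rfl (e.total_splitMul_mulRight N w).symm

/-- Discarding the process memory commutes with a channel that leaves nothing else idle. -/
lemma traceOutRight_comp_localAction_splitTrivial {X Y : System P} (Λ : Op X Y) (m : ℕ+) :
    traceOutRight (Idx Y) (Fin m) ∘ₗ localAction Λ (regroupFree (splitTrivial X) m)
      (regroupFree (splitTrivial Y) m) = Λ ∘ₗ traceOutRight (Idx X) (Fin m) := by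
  refine LinearMap.ext fun ρ => ?_
  have h : traceOutRight (Idx X) (Fin m) ρ =
      ∑ x : Fin m, Matrix.of fun i j => ρ (i, x) (j, x) := by
    ext i j
    simp [traceOutRight, Matrix.sum_apply]
  rw [LinearMap.comp_apply, LinearMap.comp_apply, h, map_sum]
  ext k l
  rw [Matrix.sum_apply]
  rfl

/-- The process memory may be discarded before or after the idle register is split off. -/
lemma traceOutRight_eq_of_splitMul (Y N : System P) (m : ℕ+) :
    relabel (splitMul Y N).total.symm ∘ₗ ampliate (traceOutRight (Idx Y) (Fin m)) (Idx N) ∘ₗ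
      relabel (regroupUse (splitMul Y N) m) = traceOutRight (Idx (Y * N)) (Fin m) := by
  refine LinearMap.ext fun ρ => ?_
  ext k l
  refine Finset.sum_congr (M := ℂ) (s₁ := Finset.univ (α := Fin m)) rfl fun x _ => ?_
  exact congrArg₂ ρ (Prod.ext ((splitMul Y N).total.symm_apply_apply k) rfl)
    (Prod.ext ((splitMul Y N).total.symm_apply_apply l) rfl)

end Splits

section Manipulations

variable {P : Type} [Fintype P] [DecidableEq P] {S : OpClass P}

lemma Manipulation.isChannel_run (hS : ∀ X Y : System P, ∀ Λ ∈ S X Y, IsChannel Λ)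
    {L : List (System P × System P)} {W Y : System P} (Θ : Manipulation S L W Y) {m : ℕ+}
    (E : NetworkProcess P L m) : IsChannel (Θ.run E) := by
  induction Θ generalizing m with
  | done Y => cases E; exact isChannel_traceOutRight
  | free e e' Λ hΛ rest ih =>
    exact (ih E).comp (isChannel_localAction (hS _ _ Λ hΛ) _ _)
  | use e e' rest ih =>
    cases E with
    | cons E₁ hE₁ E₂ => exact (ih E₂).comp (isChannel_localAction hE₁ _ _)

lemma Manipulation.isChannel_apply (hS : ∀ X Y : System P, ∀ Λ ∈ S X Y, IsChannel Λ)
    {L : List (System P × System P)} {W Y : System P} (Θ : Manipulation S L W Y)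
    (E : NetworkProcess P L 1) : IsChannel (Θ.apply E) :=
  (Θ.isChannel_run hS E).comp isChannel_adjoinTrivial

/-! ### Running a manipulation next to idle registers -/

/-- The manipulation that runs `Θ` on one register while the register `N` stays idle, and then
applies `Λ` to both of them. -/
def Manipulation.withIdle {L : List (System P × System P)} {W Y : System P} (N : System P)
    {Z : System P} (Λ : Op (Y * N) Z) (hΛ : Λ ∈ S (Y * N) Z) :
    Manipulation S L W Y → Manipulation S L (W * N) Z
  | .done _ => .free (splitTrivial _) (splitTrivial _) Λ hΛ (.done Z)
  | .free e e' Λ' hΛ' rest => .free (e.mulRight N) (e'.mulRight N) Λ' hΛ' (rest.withIdle N Λ hΛ)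
  | .use e e' rest => .use (e.mulRight N) (e'.mulRight N) (rest.withIdle N Λ hΛ)

/-- Up to regrouping of tensor factors, `Θ.withIdle N Λ` implements `Λ ∘ (Θ(E) ⊗ id_N)`. -/
lemma Manipulation.withIdle_run {L : List (System P × System P)} {W Y : System P}
    (Θ : Manipulation S L W Y) (N : System P) {Z : System P} (Λ : Op (Y * N) Z)
    (hΛ : Λ ∈ S (Y * N) Z) {m : ℕ+} (E : NetworkProcess P L m) :
    (Θ.withIdle N Λ hΛ).run E = Λ ∘ₗ relabel (splitMul Y N).total.symm ∘ₗ
      ampliate (Θ.run E) (Idx N) ∘ₗ relabel (regroupUse (splitMul W N) m) := by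
  induction Θ generalizing m with
  | done Y =>
    cases E
    change traceOutRight (Idx Z) (Fin m) ∘ₗ localAction Λ (regroupFree (splitTrivial (Y * N)) m)
      (regroupFree (splitTrivial Z) m) = Λ ∘ₗ _
    rw [traceOutRight_comp_localAction_splitTrivial, ← traceOutRight_eq_of_splitMul]
    rfl
  | free e e' Λ' hΛ' rest ih =>
    have h := regroupFree_mulRight e N m
    have h' := regroupFree_mulRight e' N m
    have key : localAction Λ' (regroupFree (e.mulRight N) m) (regroupFree (e'.mulRight N) m) =
        localAction (localAction Λ' (regroupFree e m) (regroupFree e' m))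
          (regroupUse (splitMul _ N) m) (regroupUse (splitMul _ N) m) := by
      rw [localAction_localAction, h, h', localAction_trans_prodCongr]
    change (rest.withIdle N Λ hΛ).run E ∘ₗ localAction Λ' (regroupFree (e.mulRight N) m)
      (regroupFree (e'.mulRight N) m) = _ ∘ₗ _ ∘ₗ (ampliate (rest.run E) (Idx N) ∘ₗ
        ampliate (localAction Λ' (regroupFree e m) (regroupFree e' m)) (Idx N)) ∘ₗ _
    rw [ih, key, LinearMap.comp_assoc, LinearMap.comp_assoc, LinearMap.comp_assoc,
      LinearMap.comp_assoc, relabel_comp_localAction]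
  | use e e' rest ih =>
    cases E with
    | cons E₁ hE₁ E₂ =>
      rename_i m'
      have h := regroupUse_mulRight e N m
      have h' := regroupUse_mulRight e' N m'
      have key : localAction E₁ (regroupUse (e.mulRight N) m) (regroupUse (e'.mulRight N) m') =
          localAction (localAction E₁ (regroupUse e m) (regroupUse e' m'))
            (regroupUse (splitMul _ N) m) (regroupUse (splitMul _ N) m') := by
        rw [localAction_localAction, h, h', localAction_trans_prodCongr]
      change (rest.withIdle N Λ hΛ).run E₂ ∘ₗ localAction E₁ (regroupUse (e.mulRight N) m)
        (regroupUse (e'.mulRight N) m') = _ ∘ₗ _ ∘ₗ (ampliate (rest.run E₂) (Idx N) ∘ₗ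
          ampliate (localAction E₁ (regroupUse e m) (regroupUse e' m')) (Idx N)) ∘ₗ _
      rw [ih, key, LinearMap.comp_assoc, LinearMap.comp_assoc, LinearMap.comp_assoc,
        LinearMap.comp_assoc, relabel_comp_localAction]

/-- The manipulation that applies `Λ₁`, runs `Θ` on one register while the register `N` stays
idle, and then applies `Λ₂`. -/
def Manipulation.sandwich {L : List (System P × System P)} {V W Y Z : System P} (N : System P)
    (Λ₁ : Op V (W * N)) (h₁ : Λ₁ ∈ S V (W * N)) (Θ : Manipulation S L W Y)
    (Λ₂ : Op (Y * N) Z) (h₂ : Λ₂ ∈ S (Y * N) Z) : Manipulation S L V Z :=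
  .free (splitTrivial _) (splitTrivial _) Λ₁ h₁ (Θ.withIdle N Λ₂ h₂)

lemma Manipulation.sandwich_apply {L : List (System P × System P)} {V W Y Z : System P}
    (N : System P) (Λ₁ : Op V (W * N)) (h₁ : Λ₁ ∈ S V (W * N)) (Θ : Manipulation S L W Y)
    (Λ₂ : Op (Y * N) Z) (h₂ : Λ₂ ∈ S (Y * N) Z) (E : NetworkProcess P L 1) :
    (Manipulation.sandwich N Λ₁ h₁ Θ Λ₂ h₂).apply E = Λ₂ ∘ₗ relabel (splitMul Y N).total.symm ∘ₗ
      ampliate (Θ.apply E) (Idx N) ∘ₗ relabel (splitMul W N).total ∘ₗ Λ₁ := by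
  change (Θ.withIdle N Λ₂ h₂).run E ∘ₗ localAction Λ₁ _ _ ∘ₗ adjoinTrivial _ = _
  rw [Manipulation.withIdle_run]
  rfl

/-- Some manipulation exists between any two systems: before each round, discard everything and
prepare a product state. -/
lemma nonempty_manipulation
    (h : ∀ X Y : System P, localProduct (fun _ => discardPrepare 0) ∈ S X Y)
    (L : List (System P × System P)) (W Y : System P) : Nonempty (Manipulation S L W Y) := by
  induction L generalizing W with
  | nil => exact ⟨.free (splitTrivial _) (splitTrivial _) _ (h W Y) (.done Y)⟩
  | cons R L ih =>
    obtain ⟨I, O⟩ := R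
    obtain ⟨Θ⟩ := ih O
    exact ⟨.free (splitTrivial _) (splitTrivial _) _ (h W I)
      (.use (splitTrivial _) (splitTrivial _) Θ)⟩

end Manipulations

/-! ### Fourth moments of a Haar random unit vector -/

section Haar

variable {d : ℕ+}

instance instIsProbabilityMeasureHaarU : IsProbabilityMeasure (haarU d) :=
  ⟨by simpa [haarU] using
    Measure.haarMeasure_self (K₀ := (⊤ : TopologicalSpace.PositiveCompacts (UGroup d)))⟩

instance instIsMulLeftInvariantHaarU : (haarU d).IsMulLeftInvariant :=
  inferInstanceAs (Measure.haarMeasure ⊤).IsMulLeftInvariant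

/-- The `i`-th coordinate of the random unit vector `U|0⟩`. -/
def randomCoord (i : Fin d) (U : UGroup d) : ℂ := (U : Matrix (Fin d) (Fin d) ℂ) i 0

@[fun_prop]
lemma continuous_randomCoord (i : Fin d) : Continuous (randomCoord i) :=
  (continuous_apply_apply i 0).comp continuous_subtype_val

/-- The fourth moment `∫ uᵢ ūⱼ uₖ ūₗ` of the random unit vector `u = U|0⟩`. -/
def moment (i j k l : Fin d) : ℂ :=
  ∫ U, randomCoord i U * star (randomCoord j U) * randomCoord k U *
    star (randomCoord l U) ∂(haarU d)

lemma integrable_of_continuous {f : UGroup d → ℂ} (hf : Continuous f) : Integrable f (haarU d) :=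
  hf.integrable_of_hasCompactSupport (HasCompactSupport.of_compactSpace f)

lemma randomCoord_mul (V U : UGroup d) (i : Fin d) : randomCoord i (V * U) =
    ∑ p, (V : Matrix (Fin d) (Fin d) ℂ) i p * randomCoord p U := by
  simp [randomCoord, Matrix.mul_apply]

/-- The fourth moments form a tensor that is invariant under every unitary `V`. -/
lemma moment_eq_sum (V : UGroup d) (i j k l : Fin d) :
    moment i j k l = ∑ p, (V : Matrix (Fin d) (Fin d) ℂ) i p *
      ∑ q, star ((V : Matrix (Fin d) (Fin d) ℂ) j q) * ∑ r, (V : Matrix (Fin d) (Fin d) ℂ) k r *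
        ∑ s, star ((V : Matrix (Fin d) (Fin d) ℂ) l s) * moment p q r s := by
  have h := integral_mul_left_eq_self (μ := haarU d) (fun U => randomCoord i U *
    star (randomCoord j U) * randomCoord k U * star (randomCoord l U)) V
  have h₁ : ∀ (i : Fin d) (U : UGroup d) (x y : ℂ),
      ∑ p, (V : Matrix (Fin d) (Fin d) ℂ) i p * (x * randomCoord p U * y) =
        x * randomCoord i (V * U) * y := by
    intro i U x y
    rw [randomCoord_mul, Finset.mul_sum, Finset.sum_mul]
    exact Finset.sum_congr rfl fun p _ => by ring
  have h₂ : ∀ (i : Fin d) (U : UGroup d) (x y : ℂ),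
      ∑ p, star ((V : Matrix (Fin d) (Fin d) ℂ) i p) * (x * star (randomCoord p U) * y) =
        x * star (randomCoord i (V * U)) * y := by
    intro i U x y
    rw [randomCoord_mul, star_sum, Finset.mul_sum, Finset.sum_mul]
    exact Finset.sum_congr rfl fun p _ => by rw [star_mul']; ring
  -- expand the coordinates of `V U|0⟩`, innermost sum first
  have key : ∀ U : UGroup d, randomCoord i (V * U) * star (randomCoord j (V * U)) *
      randomCoord k (V * U) * star (randomCoord l (V * U)) =
      ∑ p, (V : Matrix (Fin d) (Fin d) ℂ) i p * ∑ q, star ((V : Matrix (Fin d) (Fin d) ℂ) j q) *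
        ∑ r, (V : Matrix (Fin d) (Fin d) ℂ) k r * ∑ s, star ((V : Matrix (Fin d) (Fin d) ℂ) l s) *
          (randomCoord p U * star (randomCoord q U) * randomCoord r U *
            star (randomCoord s U)) := by
    intro U
    have h₂' := fun i x => h₂ i U x 1
    simp only [mul_one] at h₂'
    have h₁' := fun i y => h₁ i U 1 y
    simp only [one_mul] at h₁'
    simp only [h₂', h₁]
    have h₃ : ∀ p, ∑ q, star ((V : Matrix (Fin d) (Fin d) ℂ) j q) * (randomCoord p U *
        star (randomCoord q U) * randomCoord k (V * U) * star (randomCoord l (V * U))) =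
        randomCoord p U * (star (randomCoord j (V * U)) * (randomCoord k (V * U) *
          star (randomCoord l (V * U)))) := by
      intro p
      simp only [mul_assoc] at h₂ ⊢
      rw [h₂]
    simp only [h₃, h₁']
    ring
  rw [moment, ← h]
  simp_rw [key]
  rw [integral_finsetSum _ fun _ _ => integrable_of_continuous (by fun_prop)]
  refine Finset.sum_congr rfl fun p _ => ?_
  rw [integral_const_mul, integral_finsetSum _ fun _ _ => integrable_of_continuous (by fun_prop)]
  congr 1
  refine Finset.sum_congr rfl fun q _ => ?_
  rw [integral_const_mul, integral_finsetSum _ fun _ _ => integrable_of_continuous (by fun_prop)]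
  congr 1
  refine Finset.sum_congr rfl fun r _ => ?_
  rw [integral_const_mul, integral_finsetSum _ fun _ _ => integrable_of_continuous (by fun_prop)]
  congr 1
  refine Finset.sum_congr rfl fun s _ => ?_
  rw [integral_const_mul, moment]

lemma moment_comm_left (i j k l : Fin d) : moment i j k l = moment k j i l := by
  simp only [moment]
  exact integral_congr_ae (.of_forall fun U => by ring)

lemma moment_comm_right (i j k l : Fin d) : moment i j k l = moment i l k j := by
  simp only [moment]
  exact integral_congr_ae (.of_forall fun U => by ring)

/-- The unitary that multiplies the `p`-th basis vector by the imaginary unit. -/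
def phaseUnitary (p : Fin d) : UGroup d :=
  ⟨Matrix.diagonal fun q => if q = p then Complex.I else 1, by
    rw [Matrix.mem_unitaryGroup_iff, Matrix.star_eq_conjTranspose, Matrix.diagonal_conjTranspose,
      Matrix.diagonal_mul_diagonal, ← Matrix.diagonal_one]
    congr 1
    funext q
    by_cases h : q = p <;> simp [h]⟩

/-- The fourth moments are invariant under multiplying the `p`-th coordinate by `√-1`. -/
lemma moment_phase (p i j k l : Fin d) : moment i j k l =
    (if i = p then Complex.I else 1) * (star (if j = p then Complex.I else 1) *
      ((if k = p then Complex.I else 1) * (star (if l = p then Complex.I else 1) *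
        moment i j k l))) := by
  have h₁ : ∀ (i : Fin d) (f : Fin d → ℂ),
      ∑ q, (phaseUnitary p : Matrix (Fin d) (Fin d) ℂ) i q * f q =
        (if i = p then Complex.I else 1) * f i := by
    simp [phaseUnitary, Matrix.diagonal_apply]
  have h₂ : ∀ (i : Fin d) (f : Fin d → ℂ),
      ∑ q, star ((phaseUnitary p : Matrix (Fin d) (Fin d) ℂ) i q) * f q =
        star (if i = p then Complex.I else 1) * f i := by
    intro i f
    have h := congrArg star (h₁ i fun q => star (f q))
    simpa only [star_sum, star_mul', star_star] using h
  conv_lhs => rw [moment_eq_sum (phaseUnitary p)]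
  simp only [h₁, h₂]

lemma eq_zero_of_mul_eq_self {c z : ℂ} (h : z = c * z) (hc : c ≠ 1) : z = 0 := by
  have : (1 - c) * z = 0 := by linear_combination h
  rcases mul_eq_zero.mp this with h | h
  · exact absurd (sub_eq_zero.mp h).symm hc
  · exact h

/-- By invariance under phases, only moments in which every `uᵢ` is matched with an `ūᵢ`
survive. -/
lemma moment_eq_zero {i j k l : Fin d} (h₁ : ¬(i = j ∧ k = l)) (h₂ : ¬(i = l ∧ k = j)) :
    moment i j k l = 0 := by
  by_cases hij : i = j
  · subst hij
    have hkl : k ≠ l := fun h => h₁ ⟨rfl, h⟩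
    refine eq_zero_of_mul_eq_self (c := Complex.I) ?_ (by simp [Complex.ext_iff])
    have := moment_phase k i i k l
    by_cases hik : i = k <;> simp [hik, hkl.symm, ← mul_assoc] at this ⊢ <;> exact this
  · by_cases hkj : k = j
    · subst hkj
      have hil : i ≠ l := fun h => h₂ ⟨h, rfl⟩
      refine eq_zero_of_mul_eq_self (c := Complex.I) ?_ (by simp [Complex.ext_iff])
      have := moment_phase i i k k l
      simpa [Ne.symm hij, hil.symm] using this
    · have := moment_phase j i j k l
      by_cases hlj : l = j
      · refine eq_zero_of_mul_eq_self (c := -1) ?_ (by norm_num [Complex.ext_iff])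
        simpa [hij, hkj, hlj, ← mul_assoc] using this
      · refine eq_zero_of_mul_eq_self (c := -Complex.I) ?_ (by simp [Complex.ext_iff])
        simpa [hij, hkj, hlj] using this

/-- A unitary that mixes the basis vectors `i ≠ k` with equal weights and fixes the others. It is
`1 - (1 - √-1) Q`, where `Q` is the projector onto the line spanned by the sum of the two
vectors. -/
def mixMatrix (i k : Fin d) : Matrix (Fin d) (Fin d) ℂ :=
  1 - ((1 - Complex.I) / 2) • (Matrix.single i i 1 + Matrix.single i k 1 + Matrix.single k i 1 +
    Matrix.single k k 1)

lemma mixMatrix_mem {i k : Fin d} (h : i ≠ k) : mixMatrix i k ∈ Matrix.unitaryGroup (Fin d) ℂ := by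
  rw [Matrix.mem_unitaryGroup_iff, Matrix.star_eq_conjTranspose]
  set Q : Matrix (Fin d) (Fin d) ℂ := Matrix.single i i 1 + Matrix.single i k 1 +
    Matrix.single k i 1 + Matrix.single k k 1 with hQ
  have h1 : Q * Q = (2 : ℂ) • Q := by
    simp only [hQ, Matrix.mul_add, Matrix.add_mul, Matrix.single_mul_single_same, mul_one,
      Matrix.single_mul_single_of_ne _ _ _ _ h, Matrix.single_mul_single_of_ne _ _ _ _ h.symm,
      two_smul]
    abel
  have h2 : Q.conjTranspose = Q := by
    simp only [hQ, Matrix.conjTranspose_add, Matrix.conjTranspose_single, star_one]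
    abel
  have h3 : mixMatrix i k = 1 - ((1 - Complex.I) / 2) • Q := rfl
  have h4 : (mixMatrix i k).conjTranspose = 1 - ((1 + Complex.I) / 2) • Q := by
    rw [h3, Matrix.conjTranspose_sub, Matrix.conjTranspose_one, Matrix.conjTranspose_smul, h2]
    simp
  rw [h4, h3]
  simp only [Matrix.mul_sub, Matrix.sub_mul, smul_mul_assoc, mul_smul_comm, h1, Matrix.one_mul,
    Matrix.mul_one, smul_smul]
  have h5 : (1 - Complex.I) / 2 * ((1 + Complex.I) / 2 * 2) - 1 = 0 := by
    linear_combination (-1 / 2) * Complex.I_sq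
  rw [← sub_eq_zero, ← zero_smul ℂ Q, ← h5]
  module

lemma mixMatrix_sum {i k : Fin d} (h : i ≠ k) (f : Fin d → ℂ) :
    ∑ p, mixMatrix i k i p * f p =
      (1 + Complex.I) / 2 * f i + (Complex.I - 1) / 2 * f k := by
  have h1 : ∀ p, mixMatrix i k i p = (if p = i then (1 + Complex.I) / 2 else 0) +
      if p = k then (Complex.I - 1) / 2 else 0 := by
    intro p
    by_cases h1 : p = i
    · subst h1
      simp [mixMatrix, h, h.symm]
      ring
    · by_cases h2 : p = k
      · subst h2
        simp [mixMatrix, h, h.symm]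
        ring
      · simp [mixMatrix, h1, h2, Ne.symm h1, Ne.symm h2, h.symm]
  simp [h1, add_mul, Finset.sum_add_distrib]

lemma mixMatrix_sum_star {i k : Fin d} (h : i ≠ k) (f : Fin d → ℂ) :
    ∑ p, star (mixMatrix i k i p) * f p =
      (1 - Complex.I) / 2 * f i + (-Complex.I - 1) / 2 * f k := by
  have h1 := congrArg star (mixMatrix_sum h fun p => star (f p))
  simpa [star_sum, sub_eq_add_neg] using h1

/-- Invariance under `mixMatrix i k`, where the `16` terms of the expansion reduce to those with
matched indices. The right side is symmetric in `i` and `k`, so `moment i i i i = moment k k k k`,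
and therefore `moment i i i i = 2 * moment i i k k`. -/
lemma moment_mix {i k : Fin d} (h : i ≠ k) :
    4 * moment i i i i = moment i i i i + moment k k k k + 4 * moment i i k k := by
  have h1 := moment_eq_sum ⟨mixMatrix i k, mixMatrix_mem h⟩ i i i i
  simp only [mixMatrix_sum h, mixMatrix_sum_star h] at h1
  rw [moment_eq_zero (i := i) (j := i) (k := i) (l := k) (by simp [h]) (by simp [h]),
    moment_eq_zero (i := i) (j := i) (k := k) (l := i) (by simp [h.symm]) (by simp [h.symm]),
    moment_eq_zero (i := i) (j := k) (k := i) (l := i) (by simp [h]) (by simp [h]),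
    moment_eq_zero (i := i) (j := k) (k := i) (l := k) (by simp [h]) (by simp [h]),
    moment_eq_zero (i := i) (j := k) (k := k) (l := k) (by simp [h]) (by simp [h]),
    moment_eq_zero (i := k) (j := i) (k := i) (l := i) (by simp [h.symm]) (by simp [h.symm]),
    moment_eq_zero (i := k) (j := i) (k := k) (l := i) (by simp [h.symm]) (by simp [h.symm]),
    moment_eq_zero (i := k) (j := i) (k := k) (l := k) (by simp [h.symm]) (by simp [h.symm]),
    moment_eq_zero (i := k) (j := k) (k := i) (l := k) (by simp [h]) (by simp [h]),
    moment_eq_zero (i := k) (j := k) (k := k) (l := i) (by simp [h.symm]) (by simp [h.symm]),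
    moment_comm_right i k k i, moment_comm_left k i i k, moment_comm_left k k i i,
    moment_comm_right i k k i] at h1
  -- all entries of the mixing matrix in the plane of `i` and `k` have modulus `1 / √2`
  generalize moment i i i i = x at *
  generalize moment k k k k = y at *
  generalize moment i i k k = z at *
  have hA : (1 + Complex.I) / 2 * ((1 - Complex.I) / 2) = 1 / 2 := by
    linear_combination (-1 / 4) * Complex.I_sq
  have hB : (Complex.I - 1) / 2 * ((-Complex.I - 1) / 2) = 1 / 2 := by
    linear_combination (-1 / 4) * Complex.I_sq
  generalize (1 + Complex.I) / 2 = A at *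
  generalize (1 - Complex.I) / 2 = A' at *
  generalize (Complex.I - 1) / 2 = B at *
  generalize (-Complex.I - 1) / 2 = B' at *
  linear_combination 4 * h1 + 4 * x * (A * A' + 1 / 2) * hA + 4 * y * (B * B' + 1 / 2) * hB +
    16 * z * (B * B' * hA + 1 / 2 * hB)

/-- Normalization: the sum is `∫ ‖u‖⁴`. -/
lemma sum_moment : ∑ i : Fin d, ∑ k, moment i i k k = 1 := by
  have h1 : ∀ U : UGroup d, ∑ i, randomCoord i U * star (randomCoord i U) = 1 := by
    intro U
    have := congrFun (congrFun (Matrix.mem_unitaryGroup_iff'.mp U.2) 0) 0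
    rw [Matrix.mul_apply] at this
    simpa [randomCoord, mul_comm] using this
  simp only [moment]
  have h2 : ∀ i k : Fin d, Integrable (fun U => randomCoord i U * star (randomCoord i U) *
      randomCoord k U * star (randomCoord k U)) (haarU d) := fun i k =>
    integrable_of_continuous (by fun_prop)
  simp_rw [← integral_finsetSum _ fun k _ => h2 _ k]
  rw [← integral_finsetSum _ fun i _ => integrable_finsetSum _ fun k _ => h2 i k]
  simp_rw [mul_assoc, ← Finset.mul_sum, h1]
  simp_rw [mul_one, h1]
  simp

/-- The fourth moments are fixed by their symmetries and the normalization. -/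
lemma moment_eq (i j k l : Fin d) : moment i j k l =
    ((if i = j ∧ k = l then 1 else 0) + if i = l ∧ k = j then 1 else 0) /
      ((d : ℂ) * ((d : ℂ) + 1)) := by
  -- the right side of `moment_mix` is symmetric in `i` and `k`
  have hdiag : ∀ i k : Fin d, moment i i i i = moment k k k k := by
    intro i k
    by_cases h : i = k
    · rw [h]
    · have h1 := moment_mix h
      have h2 := moment_mix (Ne.symm h)
      rw [moment_comm_left k k i i, moment_comm_right i k k i] at h2
      linear_combination (h1 - h2) / 4
  have hoff : ∀ i k : Fin d, i ≠ k → moment i i k k = moment (0 : Fin d) 0 0 0 / 2 := by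
    intro i k h
    have h1 := moment_mix h
    rw [hdiag k 0, hdiag i 0] at h1
    linear_combination -h1 / 4
  have hall : ∀ i k : Fin d, moment i i k k =
      moment (0 : Fin d) 0 0 0 / 2 * (1 + if i = k then 1 else 0) := by
    intro i k
    by_cases h : i = k
    · subst h
      simp [hdiag i 0]
      ring
    · simp [h, hoff i k h]
  have hd : (d : ℂ) ≠ 0 := by exact_mod_cast d.pos.ne'
  have hd1 : (d : ℂ) + 1 ≠ 0 := Nat.cast_add_one_ne_zero (d : ℕ)
  generalize moment (0 : Fin d) 0 0 0 / 2 = c at hall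
  have hval : c = 1 / ((d : ℂ) * ((d : ℂ) + 1)) := by
    have h1 := sum_moment (d := d)
    simp_rw [hall, ← Finset.mul_sum, Finset.sum_add_distrib] at h1
    simp at h1
    field_simp
    linear_combination h1
  by_cases h₁ : i = j ∧ k = l
  · obtain ⟨rfl, rfl⟩ := h₁
    rw [hall, hval, one_div_mul_eq_div]
    by_cases h : i = k
    · simp [h]
    · simp [h, Ne.symm h]
  · by_cases h₂ : i = l ∧ k = j
    · obtain ⟨rfl, rfl⟩ := h₂
      rw [moment_comm_right, hall, hval]
      have h : i ≠ k := fun h => h₁ ⟨h, h.symm⟩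
      simp [h]
    · simp [moment_eq_zero h₁ h₂, h₁, h₂]

/-! ### Average fidelity and entanglement fidelity -/

/-- The sum `∑ᵢⱼ ⟨i|N(|i⟩⟨j|)|j⟩`, which is `d²` times the entanglement fidelity of `N`. -/
def entanglementSum {n : ℕ} (N : OpMap (Fin n) (Fin n)) : ℂ :=
  ∑ i, ∑ j, N (Matrix.single i j 1) i j

/-- The average fidelity in terms of the entanglement fidelity. Of the two terms of the fourth
moment, one contributes the traces of `N(|i⟩⟨i|)`, the other one the entanglement fidelity. -/
lemma integral_trace_mul (N : OpMap (Fin d) (Fin d)) (hN : IsTracePreserving N) :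
    ∫ U : UGroup d, ((pureState U * N (pureState U)).trace).re ∂(haarU d) =
      ((d : ℝ) + (entanglementSum N).re) / ((d : ℝ) * ((d : ℝ) + 1)) := by
  have hψ : ∀ U : UGroup d, ∀ i j, pureState U i j = randomCoord i U * star (randomCoord j U) := by
    intro U i j
    simp [pureState, randomCoord, Matrix.mul_apply, Matrix.single_apply, ite_and]
  have h1 : ∀ U : UGroup d, (pureState U * N (pureState U)).trace =
      ∑ k, ∑ l, ∑ i, ∑ j, N (Matrix.single i j 1) l k * (randomCoord k U *
        star (randomCoord l U) * randomCoord i U * star (randomCoord j U)) := by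
    intro U
    have h2 : N (pureState U) = ∑ i, ∑ j, pureState U i j • N (Matrix.single i j 1) := by
      conv_lhs => rw [Matrix.matrix_eq_sum_single (pureState U)]
      simp only [map_sum]
      refine Finset.sum_congr rfl fun i _ => Finset.sum_congr rfl fun j _ => ?_
      rw [← map_smul, Matrix.smul_single, smul_eq_mul, mul_one]
    simp only [Matrix.trace, Matrix.diag_apply, Matrix.mul_apply]
    refine Finset.sum_congr rfl fun k _ => Finset.sum_congr rfl fun l _ => ?_
    simp only [h2, Matrix.sum_apply, Matrix.smul_apply, smul_eq_mul, Finset.mul_sum, hψ]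
    refine Finset.sum_congr rfl fun i _ => Finset.sum_congr rfl fun j _ => ?_
    ring
  have h3 : ∫ U : UGroup d, (pureState U * N (pureState U)).trace ∂(haarU d) =
      ∑ k, ∑ l, ∑ i, ∑ j, N (Matrix.single i j 1) l k * moment k l i j := by
    simp_rw [h1]
    rw [integral_finsetSum _ fun _ _ => integrable_of_continuous (by fun_prop)]
    refine Finset.sum_congr rfl fun k _ => ?_
    rw [integral_finsetSum _ fun _ _ => integrable_of_continuous (by fun_prop)]
    refine Finset.sum_congr rfl fun l _ => ?_
    rw [integral_finsetSum _ fun _ _ => integrable_of_continuous (by fun_prop)]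
    refine Finset.sum_congr rfl fun i _ => ?_
    rw [integral_finsetSum _ fun _ _ => integrable_of_continuous (by fun_prop)]
    refine Finset.sum_congr rfl fun j _ => ?_
    rw [integral_const_mul]
    rfl
  have hcont : Continuous fun U : UGroup d => (pureState U * N (pureState U)).trace := by
    simp_rw [h1]
    fun_prop
  have htr : ∑ i : Fin d, ∑ k : Fin d, N (Matrix.single i i 1) k k = d := by
    have h5 : ∀ i : Fin d, ∑ k : Fin d, N (Matrix.single i i 1) k k = 1 := fun i => by
      simpa [Matrix.trace] using hN (Matrix.single i i 1)
    simp [h5]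
  have h4 : ∑ k, ∑ l, ∑ i, ∑ j, N (Matrix.single i j 1) l k * moment k l i j =
      ((d : ℂ) + entanglementSum N) / ((d : ℂ) * ((d : ℂ) + 1)) := by
    simp only [moment_eq, mul_div_assoc', ← Finset.sum_div, mul_add, Finset.sum_add_distrib]
    congr 1
    rw [← htr, entanglementSum]
    simp only [ite_and, mul_ite, mul_one, mul_zero, Finset.sum_ite_irrel, Finset.sum_ite_eq,
      Finset.sum_ite_eq', Finset.sum_const_zero, Finset.mem_univ, if_true]
    exact congrArg₂ _ Finset.sum_comm Finset.sum_comm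
  have h6 : ∫ U : UGroup d, ((pureState U * N (pureState U)).trace).re ∂(haarU d) =
      (∫ U : UGroup d, (pureState U * N (pureState U)).trace ∂(haarU d)).re :=
    integral_re (integrable_of_continuous hcont)
  rw [h6, h3, h4]
  have : ((d : ℂ) * ((d : ℂ) + 1)) = (((d : ℝ) * ((d : ℝ) + 1) : ℝ) : ℂ) := by push_cast; ring
  rw [this, Complex.div_ofReal_re]
  simp

end Haar

/-! ### The Weyl operator basis -/

section Weyl

variable {n : ℕ}

/-- The standard primitive `n`-th root of unity. -/
def rootOfUnity (n : ℕ) : ℂ := Complex.exp (2 * Real.pi * Complex.I / n)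

lemma rootOfUnity_ne_zero : rootOfUnity n ≠ 0 := Complex.exp_ne_zero _

/-- The Weyl operator `X ^ s Z ^ t`, where `X` is the cyclic shift and `Z` the clock operator. -/
def weyl (m : Fin n × Fin n) : Matrix (Fin n) (Fin n) ℂ :=
  Matrix.of fun i j => if j + m.1 = i then rootOfUnity n ^ ((m.2 : ℕ) * (j : ℕ)) else 0

lemma weyl_apply (m : Fin n × Fin n) (i j : Fin n) :
    weyl m i j = if j + m.1 = i then rootOfUnity n ^ ((m.2 : ℕ) * (j : ℕ)) else 0 := rfl

variable [NeZero n]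

lemma isPrimitiveRoot_rootOfUnity : IsPrimitiveRoot (rootOfUnity n) n :=
  Complex.isPrimitiveRoot_exp n (NeZero.ne n)

lemma star_rootOfUnity : star (rootOfUnity n) = (rootOfUnity n)⁻¹ :=
  (Complex.inv_eq_conj (isPrimitiveRoot_rootOfUnity.norm'_eq_one (NeZero.ne n))).symm

lemma weyl_isometry (m : Fin n × Fin n) (x y : Fin n) :
    ∑ i, star (weyl m i x) * weyl m i y = if x = y then 1 else 0 := by
  simp only [weyl_apply, mul_ite, mul_zero, Finset.sum_ite_eq, Finset.mem_univ, if_true]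
  by_cases h : x = y
  · subst h
    simp [star_rootOfUnity, rootOfUnity_ne_zero]
  · simp [h]

/-- Orthogonality of the characters of `ℤ / n`. -/
lemma sum_rootOfUnity (x y : Fin n) :
    ∑ t : Fin n, rootOfUnity n ^ ((t : ℕ) * (x : ℕ)) * star (rootOfUnity n ^ ((t : ℕ) * (y : ℕ))) =
      if x = y then (n : ℂ) else 0 := by
  have h0 := rootOfUnity_ne_zero (n := n)
  set z := rootOfUnity n ^ (x : ℕ) * (rootOfUnity n ^ (y : ℕ))⁻¹ with hz
  have h1 : ∀ t : Fin n, rootOfUnity n ^ ((t : ℕ) * (x : ℕ)) *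
      star (rootOfUnity n ^ ((t : ℕ) * (y : ℕ))) = z ^ (t : ℕ) := by
    intro t
    rw [star_pow, star_rootOfUnity, hz, mul_pow, inv_pow, inv_pow, ← pow_mul, ← pow_mul,
      mul_comm (t : ℕ), mul_comm (t : ℕ)]
  simp_rw [h1]
  rw [Fin.sum_univ_eq_sum_range (fun t => z ^ t)]
  by_cases h : x = y
  · subst h
    have : z = 1 := mul_inv_cancel₀ (pow_ne_zero _ h0)
    simp [this]
  · have hz1 : z ≠ 1 := by
      intro hz1
      rw [hz, mul_inv_eq_one₀ (pow_ne_zero _ h0)] at hz1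
      exact h (Fin.ext (isPrimitiveRoot_rootOfUnity.pow_inj x.2 y.2 hz1))
    have hzn : z ^ n = 1 := by
      rw [hz, mul_pow, inv_pow, ← pow_mul, ← pow_mul, mul_comm (x : ℕ), mul_comm (y : ℕ), pow_mul,
        pow_mul, isPrimitiveRoot_rootOfUnity.pow_eq_one]
      simp
    rw [geom_sum_eq hz1, hzn]
    simp [h]

/-- The Weyl operators form an orthogonal basis, in the form of a completeness relation. -/
lemma weyl_complete (i i' x x' : Fin n) :
    ∑ m : Fin n × Fin n, weyl m i x * star (weyl m i' x') =
      if i = i' ∧ x = x' then (n : ℂ) else 0 := by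
  have h1 : ∀ s t : Fin n, weyl (s, t) i x * star (weyl (s, t) i' x') =
      if x + s = i ∧ x' + s = i' then rootOfUnity n ^ ((t : ℕ) * (x : ℕ)) *
        star (rootOfUnity n ^ ((t : ℕ) * (x' : ℕ))) else 0 := by
    intro s t
    by_cases h : x + s = i <;> by_cases h' : x' + s = i' <;> simp [weyl_apply, h, h']
  have h2 : ∀ s : Fin n, ∑ t : Fin n, weyl (s, t) i x * star (weyl (s, t) i' x') =
      if s = i - x then if i = i' ∧ x = x' then (n : ℂ) else 0 else 0 := by
    intro s
    simp_rw [h1]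
    have h3 : x + s = i ↔ s = i - x := by rw [eq_sub_iff_add_eq, add_comm]
    by_cases h : s = i - x
    · have h4 := h3.mpr h
      rw [if_pos h]
      by_cases hx : x = x'
      · subst hx
        by_cases hi : i = i'
        · subst hi
          simp only [h4, and_self, if_true]
          rw [sum_rootOfUnity, if_pos rfl]
        · simp [h4, hi]
      · by_cases h5 : x' + s = i'
        · simp only [h4, h5, and_self, if_true, hx, and_false, if_false]
          rw [sum_rootOfUnity, if_neg hx]
        · simp [h5, hx]
    · simp [h3, h]
  rw [Fintype.sum_prod_type]
  simp only [h2, Finset.sum_ite_eq', Finset.mem_univ, if_true]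

end Weyl

/-! ### Local bases and the figures of merit in coordinates -/

/-- The basis label `x` read as a label of the basis of `ℂ^d`; a bijection if `n = d`. -/
def toFin (d : ℕ+) {n : ℕ} (x : Fin n) : Fin d := Fin.ofNat d x

lemma toFin_inj {d : ℕ+} {n : ℕ} (h : n = d) {x y : Fin n} : toFin d x = toFin d y ↔ x = y := by
  subst h
  simp [toFin]

lemma val_toFin {d : ℕ+} {n : ℕ} (h : n = d) (x : Fin n) : (toFin d x : ℕ) = x := by
  subst h
  simp [toFin]

lemma sum_toFin {d : ℕ+} {n : ℕ} (h : n = d) (f : Fin d → ℂ) :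
    ∑ x : Fin n, f (toFin d x) = ∑ x, f x := by
  subst h
  simp [toFin]

lemma inv_sqrt_mul_self (d : ℕ+) :
    ((Real.sqrt d : ℝ) : ℂ)⁻¹ * ((Real.sqrt d : ℝ) : ℂ)⁻¹ = (d : ℂ)⁻¹ := by
  rw [← mul_inv, ← Complex.ofReal_mul, Real.mul_self_sqrt (Nat.cast_nonneg _)]
  simp

section Systems

variable {P : Type} [DecidableEq P]

lemma solo_of_ne {a q : P} (h : q ≠ a) (d : ℕ+) : ((solo a d q : ℕ+) : ℕ) = 1 := by simp [solo, h]

lemma pair_of_ne {a b q : P} (h : q ≠ a) (h' : q ≠ b) (d : ℕ+) : ((pair a b d q : ℕ+) : ℕ) = 1 := by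
  simp [pair, h, h']

lemma eq_of_card_eq_one {n : ℕ} (h : n = 1) (x y : Fin n) : x = y := by
  subst h
  exact Subsingleton.elim _ _

lemma toFin_soloEquiv_symm (a : P) (d : ℕ+) (i : Fin d) :
    toFin d ((soloEquiv a d).symm i a) = i := by
  apply Fin.ext
  rw [val_toFin (solo_self a d)]
  simp [soloEquiv]

lemma val_soloEquiv_symm_of_ne {a q : P} (h : q ≠ a) (d : ℕ+) (i : Fin d) :
    ((soloEquiv a d).symm i q : ℕ) = 0 := by
  simp [soloEquiv, h]

lemma val_soloEquiv_symm_self (a : P) (d : ℕ+) (i : Fin d) :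
    ((soloEquiv a d).symm i a : ℕ) = i := by
  simp [soloEquiv]

variable [Fintype P]

/-- `f(N) = (d F + 1) / (d + 1)`, where `d² F` is the entanglement sum of `N`. -/
lemma averageFidelity_eq {a b : P} {d : ℕ+} (N : Op (solo a d) (solo b d)) (hN : IsChannel N) :
    averageFidelity N = ((d : ℝ) + (entanglementSum
      (relabel (soloEquiv b d) ∘ₗ N ∘ₗ relabel (soloEquiv a d).symm)).re) /
        ((d : ℝ) * ((d : ℝ) + 1)) := by
  rw [← integral_trace_mul _
    ((isChannel_relabel _).comp (hN.comp (isChannel_relabel (soloEquiv a d).symm))).2,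
    averageFidelity]
  refine integral_congr_ae (.of_forall fun U => congrArg Complex.re ?_)
  simp only [Matrix.trace, Matrix.diag_apply, Matrix.mul_apply, LinearMap.comp_apply, relabel_apply,
    Equiv.symm_symm]
  rw [← Equiv.sum_comp (soloEquiv b d)]
  refine Finset.sum_congr rfl fun i _ => ?_
  rw [← Equiv.sum_comp (soloEquiv b d)]
  simp

/-- The overlap with `φ⁺_d` is `1 / d` times the sum of the entries between basis vectors
`|i⟩_a |i⟩_b`. -/
lemma trace_mul_maxEntangled (a b : P) (d : ℕ+)
    (ρ : Matrix (Idx (pair a b d)) (Idx (pair a b d)) ℂ) :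
    (ρ * maxEntangled a b d).trace = 1 / (d : ℂ) *
      ∑ x : Idx (pair a b d) with (x a : ℕ) = x b, ∑ y : Idx (pair a b d) with (y a : ℕ) = y b,
        ρ x y := by
  simp only [Matrix.trace, Matrix.diag_apply, Matrix.mul_apply, maxEntangled, Matrix.of_apply]
  rw [Finset.mul_sum, Finset.sum_filter]
  refine Finset.sum_congr rfl fun x _ => ?_
  by_cases hx : (x a : ℕ) = x b
  · rw [if_pos hx, Finset.mul_sum, Finset.sum_filter]
    refine Finset.sum_congr rfl fun y _ => ?_
    by_cases hy : (y a : ℕ) = y b <;> simp [hx, hy, mul_comm]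
  · simp [hx]

end Systems

/-! ### Average fidelity from distillation: teleportation -/

section Teleportation

variable {P : Type} [DecidableEq P]

/-- The conditional Kraus operators of teleportation. The sender `a` holds half of the resource and
the message, and projects them on the maximally entangled state twisted by a Weyl operator; the
receiver `b` applies that Weyl operator to the other half of the resource. -/
def teleportMatrix (a b : P) (d : ℕ+) (m : Fin d × Fin d) (q : P) :
    Matrix (Fin (solo b d q)) (Fin ((pair a b d * solo a d) q)) ℂ :=
  Matrix.of fun k w =>
    if q = a then ((Real.sqrt d : ℝ) : ℂ)⁻¹ *
      star (weyl m (toFin d (splitMul (pair a b d) (solo a d) q w).2)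
        (toFin d (splitMul (pair a b d) (solo a d) q w).1))
    else if q = b then weyl m (toFin d k) (toFin d (splitMul (pair a b d) (solo a d) q w).1)
    else 1

lemma teleportMatrix_apply (a b : P) (d : ℕ+) (m : Fin d × Fin d) (q : P) (k : Fin (solo b d q))
    (w : Fin ((pair a b d * solo a d) q)) : teleportMatrix a b d m q k w =
      if q = a then ((Real.sqrt d : ℝ) : ℂ)⁻¹ *
        star (weyl m (toFin d (splitMul (pair a b d) (solo a d) q w).2)
          (toFin d (splitMul (pair a b d) (solo a d) q w).1))
      else if q = b then weyl m (toFin d k) (toFin d (splitMul (pair a b d) (solo a d) q w).1)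
      else 1 := rfl

/-- The measurement of the sender is complete, since the Weyl operators form an operator basis. -/
lemma teleportMatrix_sender {a b : P} (hab : a ≠ b) (d : ℕ+) :
    ∑ m, (teleportMatrix a b d m a).conjTranspose * teleportMatrix a b d m a = 1 := by
  ext w w'
  have hs : ∀ c : ℂ, ∑ _k : Fin (solo b d a), c = c := fun c => by
    simp [solo_of_ne hab d]
  have hd : (d : ℂ) ≠ 0 := by exact_mod_cast d.pos.ne'
  have hterm : ∀ m, ((teleportMatrix a b d m a).conjTranspose * teleportMatrix a b d m a) w w' =
      (d : ℂ)⁻¹ * (weyl m (toFin d (splitMul (pair a b d) (solo a d) a w).2)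
        (toFin d (splitMul (pair a b d) (solo a d) a w).1) *
      star (weyl m (toFin d (splitMul (pair a b d) (solo a d) a w').2)
        (toFin d (splitMul (pair a b d) (solo a d) a w').1))) := by
    intro m
    simp only [Matrix.mul_apply, Matrix.conjTranspose_apply, teleportMatrix_apply,
      if_true, hs]
    rw [← inv_sqrt_mul_self, star_mul', star_star]
    simp only [Complex.star_def, map_inv₀, Complex.conj_ofReal]
    ring
  rw [Matrix.sum_apply]
  simp only [hterm, ← Finset.mul_sum]
  rw [weyl_complete, Matrix.one_apply]
  have : ((splitMul (pair a b d) (solo a d) a w).2 = (splitMul (pair a b d) (solo a d) a w').2 ∧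
      (splitMul (pair a b d) (solo a d) a w).1 = (splitMul (pair a b d) (solo a d) a w').1) ↔
      w = w' := by
    rw [← (splitMul (pair a b d) (solo a d) a).apply_eq_iff_eq, Prod.ext_iff, and_comm]
  simp only [toFin_inj (solo_self a d), toFin_inj (pair_left a b d), this]
  by_cases h : w = w'
  · rw [if_pos h, if_pos h, inv_mul_cancel₀ hd]
  · rw [if_neg h, if_neg h, mul_zero]

lemma teleportMatrix_of_ne {a b : P} (d : ℕ+) (m : Fin d × Fin d) {q : P} (hq : q ≠ a) :
    (teleportMatrix a b d m q).conjTranspose * teleportMatrix a b d m q = 1 := by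
  ext w w'
  have hsnd : (splitMul (pair a b d) (solo a d) q w).2 =
      (splitMul (pair a b d) (solo a d) q w').2 :=
    eq_of_card_eq_one (solo_of_ne hq d) _ _
  have hiff : w = w' ↔ (splitMul (pair a b d) (solo a d) q w).1 =
      (splitMul (pair a b d) (solo a d) q w').1 := by
    rw [← (splitMul (pair a b d) (solo a d) q).apply_eq_iff_eq, Prod.ext_iff]
    exact and_iff_left hsnd
  rw [Matrix.one_apply, Matrix.mul_apply]
  by_cases hb : q = b
  · subst hb
    simp only [Matrix.conjTranspose_apply, teleportMatrix_apply, hq, if_false, if_true]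
    rw [sum_toFin (solo_self q d) fun k => star (weyl m k (toFin d
      (splitMul (pair a q d) (solo a d) q w).1)) * weyl m k (toFin d
      (splitMul (pair a q d) (solo a d) q w').1), weyl_isometry]
    simp only [toFin_inj (pair_right a q d), hiff]
  · have : w = w' := hiff.mpr (eq_of_card_eq_one (pair_of_ne hq hb d) _ _)
    have hterm : ∀ k, (teleportMatrix a b d m q).conjTranspose w k * teleportMatrix a b d m q k w' =
        1 := fun k => by
      rw [Matrix.conjTranspose_apply, teleportMatrix_apply, teleportMatrix_apply]
      simp [hq, hb]
    rw [if_pos this, Finset.sum_congr rfl fun k _ => hterm k]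
    simp [solo_of_ne hb d]

variable [Fintype P]

/-- Teleportation: the sum over all outcomes of the sender's measurement. -/
def teleport (a b : P) (d : ℕ+) : Op (pair a b d * solo a d) (solo b d) :=
  ∑ m, krausMap (prodMatrix (teleportMatrix a b d m))

lemma teleport_mem_LOCC₁ {a b : P} (hab : a ≠ b) {d : ℕ+} {c : ℕ} (hc : (d : ℕ) ^ 2 ≤ 2 ^ c) :
    teleport a b d ∈ LOCC₁ a c (pair a b d * solo a d) (solo b d) := by
  refine ⟨d * d, by rwa [← sq],
    fun m q => krausMap (teleportMatrix a b d (finProdFinEquiv.symm m) q),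
    fun m => isCompletelyPositive_krausMap _, ?_, fun m q hq =>
    isChannel_krausMap (teleportMatrix_of_ne d _ hq), ?_⟩
  · refine isTracePreserving_sum_krausMap ?_
    rw [Equiv.sum_comp finProdFinEquiv.symm fun m =>
      (teleportMatrix a b d m a).conjTranspose * teleportMatrix a b d m a]
    exact teleportMatrix_sender hab d
  · simp only [localProduct_krausMap]
    rw [Equiv.sum_comp finProdFinEquiv.symm fun m => krausMap (prodMatrix (teleportMatrix a b d m))]
    rfl

/-- The Kraus operator of the outcome `m`, summed along the diagonal that pairs the message with the
output, is a multiple of the maximally entangled vector, whatever `m`. -/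
lemma sum_prodMatrix_teleportMatrix {a b : P} (hab : a ≠ b) (d : ℕ+) (m : Fin d × Fin d)
    (x : Idx (pair a b d)) :
    ∑ i, prodMatrix (teleportMatrix a b d m) ((soloEquiv b d).symm i)
      ((splitMul (pair a b d) (solo a d)).total.symm (x, (soloEquiv a d).symm i)) =
        if (x a : ℕ) = x b then ((Real.sqrt d : ℝ) : ℂ)⁻¹ else 0 := by
  have h1 : ∀ i, prodMatrix (teleportMatrix a b d m) ((soloEquiv b d).symm i)
      ((splitMul (pair a b d) (solo a d)).total.symm (x, (soloEquiv a d).symm i)) =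
        ((Real.sqrt d : ℝ) : ℂ)⁻¹ *
          (star (weyl m i (toFin d (x a))) * weyl m i (toFin d (x b))) := by
    intro i
    simp only [prodMatrix_apply, teleportMatrix_apply, splitMul_total_symm_apply]
    rw [Finset.prod_eq_mul a b hab (fun q _ hq => by simp [hq.1, hq.2]) (by simp) (by simp)]
    simp only [if_true, hab.symm, if_false, toFin_soloEquiv_symm, mul_assoc]
  simp only [h1, ← Finset.mul_sum]
  rw [weyl_isometry]
  have : toFin d (x a) = toFin d (x b) ↔ (x a : ℕ) = x b := by
    rw [Fin.ext_iff, val_toFin (pair_left a b d), val_toFin (pair_right a b d)]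
  simp [this]

/-- A message system of the sender next to an empty register. -/
def messageEquiv (X : System P) (q : P) : Fin (X q) ≃ Fin ((trivialSystem * X : System P) q) :=
  (Equiv.uniqueProd (Fin (X q)) (Fin 1)).symm.trans (splitMul trivialSystem X q).symm

/-- Teleporting through the state `ρ` gives a channel whose entanglement fidelity is the overlap of
`ρ` with `φ⁺_d`; each of the `d ^ 2` outcomes contributes the same amount. -/
lemma entanglementSum_teleport {a b : P} (hab : a ≠ b) (d : ℕ+)
    (ρ : Op trivialSystem (pair a b d)) :
    entanglementSum (relabel (soloEquiv b d) ∘ₗ (teleport a b d ∘ₗ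
      relabel (splitMul (pair a b d) (solo a d)).total.symm ∘ₗ ampliate ρ (Idx (solo a d)) ∘ₗ
      relabel (splitMul trivialSystem (solo a d)).total ∘ₗ
      relabel (Equiv.piCongrRight (messageEquiv (solo a d)))) ∘ₗ relabel (soloEquiv a d).symm) =
    (d : ℂ) ^ 2 * (ρ 1 * maxEntangled a b d).trace := by
  -- the Hilbert space of the trivial system is one-dimensional
  have hid : ∀ c : ℂ, (Matrix.of fun _ _ => c :
      Matrix (Idx (trivialSystem (P := P))) (Idx (trivialSystem (P := P))) ℂ) =
      c • 1 := by
    intro c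
    ext i j
    have hij : i = j := funext fun q => eq_of_card_eq_one rfl _ _
    simp [hij]
  have hmsg : ∀ (t : Idx trivialSystem) (x : Idx (solo a d)),
      (Equiv.piCongrRight (messageEquiv (solo a d))).symm
        ((splitMul trivialSystem (solo a d)).total.symm (t, x)) = x := by
    intro t x
    funext q
    exact congrArg Prod.snd (splitMul_total_symm_apply trivialSystem (solo a d) t x q)
  -- the joint state of the resource and the message `|i⟩⟨j|`
  have hstate : ∀ i j : Fin d, ∀ x y,
      (ampliate ρ (Idx (solo a d)) (relabel (splitMul trivialSystem (solo a d)).total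
        (relabel (Equiv.piCongrRight (messageEquiv (solo a d)))
          (relabel (soloEquiv a d).symm (Matrix.single i j 1))))) x y =
      if x.2 = (soloEquiv a d).symm i ∧ y.2 = (soloEquiv a d).symm j then ρ 1 x.1 y.1 else 0 := by
    intro i j x y
    simp only [ampliate_apply, relabel_apply, hmsg, hid, map_smul, Matrix.smul_apply, smul_eq_mul,
      Equiv.symm_symm, Matrix.single_apply, Equiv.eq_symm_apply, ite_mul, one_mul, zero_mul,
      eq_comm (b := (soloEquiv a d) x.2), eq_comm (b := (soloEquiv a d) y.2)]
  have hterm : ∀ (m : Fin d × Fin d) (i j : Fin d),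
      krausMap (prodMatrix (teleportMatrix a b d m))
        (relabel (splitMul (pair a b d) (solo a d)).total.symm (ampliate ρ (Idx (solo a d))
          (relabel (splitMul trivialSystem (solo a d)).total
            (relabel (Equiv.piCongrRight (messageEquiv (solo a d)))
              (relabel (soloEquiv a d).symm (Matrix.single i j 1))))))
        ((soloEquiv b d).symm i) ((soloEquiv b d).symm j) =
      ∑ x, ∑ y, prodMatrix (teleportMatrix a b d m) ((soloEquiv b d).symm i)
          ((splitMul (pair a b d) (solo a d)).total.symm (x, (soloEquiv a d).symm i)) *
        ρ 1 x y * star (prodMatrix (teleportMatrix a b d m) ((soloEquiv b d).symm j)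
          ((splitMul (pair a b d) (solo a d)).total.symm (y, (soloEquiv a d).symm j))) := by
    intro m i j
    rw [krausMap_apply, ← Equiv.sum_comp (splitMul (pair a b d) (solo a d)).total.symm,
      Fintype.sum_prod_type]
    refine Finset.sum_congr rfl fun x _ => ?_
    simp_rw [← Equiv.sum_comp (splitMul (pair a b d) (solo a d)).total.symm]
    simp only [Fintype.sum_prod_type, relabel_apply, Equiv.symm_symm, Equiv.apply_symm_apply,
      hstate, ite_and, mul_ite, ite_mul, mul_zero, zero_mul, Finset.sum_ite_irrel,
      Finset.sum_ite_eq', Finset.sum_const_zero, Finset.mem_univ, if_true]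
  have hout : ∀ m : Fin d × Fin d, ∑ i, ∑ j, krausMap (prodMatrix (teleportMatrix a b d m))
        (relabel (splitMul (pair a b d) (solo a d)).total.symm (ampliate ρ (Idx (solo a d))
          (relabel (splitMul trivialSystem (solo a d)).total
            (relabel (Equiv.piCongrRight (messageEquiv (solo a d)))
              (relabel (soloEquiv a d).symm (Matrix.single i j 1))))))
        ((soloEquiv b d).symm i) ((soloEquiv b d).symm j) =
      (ρ 1 * maxEntangled a b d).trace := by
    intro m
    have hsum : ∀ x y, ∑ i, ∑ j, prodMatrix (teleportMatrix a b d m) ((soloEquiv b d).symm i)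
          ((splitMul (pair a b d) (solo a d)).total.symm (x, (soloEquiv a d).symm i)) *
        ρ 1 x y * star (prodMatrix (teleportMatrix a b d m) ((soloEquiv b d).symm j)
          ((splitMul (pair a b d) (solo a d)).total.symm (y, (soloEquiv a d).symm j))) =
        if (x a : ℕ) = x b then if (y a : ℕ) = y b then (d : ℂ)⁻¹ * ρ 1 x y else 0 else 0 := by
      intro x y
      simp only [← Finset.mul_sum, ← Finset.sum_mul, ← star_sum, sum_prodMatrix_teleportMatrix hab]
      rw [← inv_sqrt_mul_self]
      split_ifs
      · simp only [Complex.star_def, map_inv₀, Complex.conj_ofReal]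
        ring
      all_goals simp
    simp only [hterm]
    rw [trace_mul_maxEntangled]
    simp only [Finset.mul_sum, Finset.sum_filter, one_div, mul_ite, mul_zero]
    rw [Finset.sum_congr rfl fun i _ => Finset.sum_comm, Finset.sum_comm]
    refine Finset.sum_congr rfl fun x _ => ?_
    rw [Finset.sum_congr rfl fun i _ => Finset.sum_comm, Finset.sum_comm]
    simp only [hsum]
    split_ifs <;> simp
  simp only [entanglementSum, teleport, LinearMap.comp_apply, LinearMap.sum_apply]
  simp only [relabel_apply (soloEquiv b d), Matrix.sum_apply]
  rw [Finset.sum_congr rfl fun i _ => Finset.sum_comm, Finset.sum_comm]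
  simp only [hout]
  simp [sq]

end Teleportation

/-! ### Distillation from average fidelity: sending half of an entangled pair -/

section Distillation

variable {P : Type}

/-- The maximally entangled vector on two copies of the local system of the party `q`. -/
def prepareMatrix (X : System P) (q : P) :
    Matrix (Fin ((X * X) q)) (Fin ((trivialSystem : System P) q)) ℂ :=
  Matrix.of fun w _ => if (splitMul X X q w).1 = (splitMul X X q w).2 then
    ((Real.sqrt (X q) : ℝ) : ℂ)⁻¹ else 0

lemma prepareMatrix_apply (X : System P) (q : P) (w : Fin ((X * X) q))
    (t : Fin ((trivialSystem : System P) q)) : prepareMatrix X q w t =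
      if (splitMul X X q w).1 = (splitMul X X q w).2 then ((Real.sqrt (X q) : ℝ) : ℂ)⁻¹
      else 0 := rfl

lemma prepareMatrix_isometry (X : System P) (q : P) :
    (prepareMatrix X q).conjTranspose * prepareMatrix X q = 1 := by
  ext i j
  have hX : ((X q : ℕ+) : ℂ) ≠ 0 := by exact_mod_cast (X q).pos.ne'
  have hterm : ∀ x y, (prepareMatrix X q).conjTranspose j ((splitMul X X q).symm (x, y)) *
      prepareMatrix X q ((splitMul X X q).symm (x, y)) j =
        if x = y then ((X q : ℕ+) : ℂ)⁻¹ else 0 := by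
    intro x y
    rw [Matrix.conjTranspose_apply, prepareMatrix_apply, Equiv.apply_symm_apply,
      ← inv_sqrt_mul_self]
    by_cases h : x = y <;> simp [h]
  rw [eq_of_card_eq_one rfl i j, Matrix.mul_apply, ← Equiv.sum_comp (splitMul X X q).symm,
    Fintype.sum_prod_type]
  refine (Finset.sum_congr rfl fun x _ => Finset.sum_congr rfl fun y _ => hterm x y).trans ?_
  simp [hX]

variable [DecidableEq P]

lemma solo_mul_solo {a b : P} (hab : a ≠ b) (d : ℕ+) (q : P) :
    (((solo b d * solo a d) q : ℕ+) : ℕ) = pair a b d q := by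
  by_cases ha : q = a
  · subst ha
    simp [solo, pair, hab]
  · by_cases hb : q = b
    · subst hb
      simp [solo, pair, hab.symm]
    · simp [solo, pair, ha, hb]

/-- Two systems, one of the receiver and one of the sender, form a pair. -/
def pairEquiv {a b : P} (hab : a ≠ b) (d : ℕ+) (q : P) :
    Fin ((solo b d * solo a d) q) ≃ Fin (pair a b d q) := finCongr (solo_mul_solo hab d q)

/-- The basis vector `|i⟩_a |i⟩_b`. -/
def diagonalIdx {a b : P} (hab : a ≠ b) (d : ℕ+) (i : Fin d) : Idx (pair a b d) :=
  Equiv.piCongrRight (pairEquiv hab d) ((splitMul (solo b d) (solo a d)).total.symm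
    ((soloEquiv b d).symm i, (soloEquiv a d).symm i))

lemma val_diagonalIdx {a b : P} (hab : a ≠ b) (d : ℕ+) (i : Fin d) (q : P) :
    (diagonalIdx hab d i q : ℕ) =
      (soloEquiv a d).symm i q + solo a d q * ((soloEquiv b d).symm i q : ℕ) := rfl

variable [Fintype P]

lemma prodMatrix_prepareMatrix (a : P) (d : ℕ+) (i m : Idx (solo a d)) (t : Idx trivialSystem) :
    prodMatrix (prepareMatrix (solo a d)) ((splitMul (solo a d) (solo a d)).total.symm (i, m)) t =
      if i = m then ((Real.sqrt d : ℝ) : ℂ)⁻¹ else 0 := by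
  simp only [prodMatrix_apply, prepareMatrix_apply, splitMul_total_symm_apply]
  rw [Finset.prod_ite_zero]
  simp only [Finset.mem_univ, true_implies]
  refine if_congr funext_iff.symm ?_ rfl
  rw [Finset.prod_eq_single a (fun q _ hq => by simp [solo_of_ne hq]) (by simp)]
  simp [solo]

/-- The vectors `|i⟩_a |i⟩_b` are exactly the basis vectors whose labels at `a` and `b` agree. -/
lemma sum_diagonal {a b : P} (hab : a ≠ b) (d : ℕ+) (f : Idx (pair a b d) → ℂ) :
    ∑ x : Idx (pair a b d) with (x a : ℕ) = x b, f x = ∑ i, f (diagonalIdx hab d i) := by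
  have ha : ∀ i, (diagonalIdx hab d i a : ℕ) = i := fun i => by
    rw [val_diagonalIdx, val_soloEquiv_symm_self, val_soloEquiv_symm_of_ne hab]
    simp
  have hb : ∀ i, (diagonalIdx hab d i b : ℕ) = i := fun i => by
    rw [val_diagonalIdx, val_soloEquiv_symm_self, val_soloEquiv_symm_of_ne hab.symm,
      solo_of_ne hab.symm]
    simp
  symm
  refine Finset.sum_bij (fun i _ => diagonalIdx hab d i) (fun i _ => by simp [ha, hb])
    (fun i _ j _ h => Fin.ext ?_) (fun x hx => ⟨toFin d (x a), Finset.mem_univ _, ?_⟩)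
    (fun _ _ => rfl)
  · rw [← ha i, ← ha j, h]
  · have hx' : (x a : ℕ) = x b := by simpa using hx
    funext q
    apply Fin.ext
    by_cases hqa : q = a
    · subst hqa
      rw [ha, val_toFin (pair_left q b d)]
    · by_cases hqb : q = b
      · subst hqb
        rw [hb, val_toFin (pair_left a q d), hx']
      · exact congrArg Fin.val (eq_of_card_eq_one (pair_of_ne hqa hqb d) _ _)

/-- Sending half of a maximally entangled pair through `N` gives the normalized Choi matrix of `N`,
whose overlap with `φ⁺_d` is the entanglement fidelity of `N`. -/
lemma trace_distilled {a b : P} (hab : a ≠ b) (d : ℕ+) (N : Op (solo a d) (solo b d)) :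
    ((relabel (Equiv.piCongrRight (pairEquiv hab d)) ∘ₗ
      relabel (splitMul (solo b d) (solo a d)).total.symm ∘ₗ ampliate N (Idx (solo a d)) ∘ₗ
      relabel (splitMul (solo a d) (solo a d)).total ∘ₗ
      krausMap (prodMatrix (prepareMatrix (solo a d)))) 1 * maxEntangled a b d).trace =
    entanglementSum (relabel (soloEquiv b d) ∘ₗ N ∘ₗ relabel (soloEquiv a d).symm) /
      (d : ℂ) ^ 2 := by
  have hprep : ∀ x y, relabel (splitMul (solo a d) (solo a d)).total
      (krausMap (prodMatrix (prepareMatrix (solo a d))) 1) x y =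
        if x.1 = x.2 ∧ y.1 = y.2 then (d : ℂ)⁻¹ else 0 := by
    intro x y
    have : Unique (Idx (trivialSystem (P := P))) := ⟨⟨fun _ => 0⟩, fun _ =>
      funext fun q => eq_of_card_eq_one rfl _ _⟩
    rw [relabel_apply, krausMap_apply, Fintype.sum_unique, Fintype.sum_unique, Matrix.one_apply_eq,
      mul_one, prodMatrix_prepareMatrix, prodMatrix_prepareMatrix, ← inv_sqrt_mul_self]
    by_cases h : x.1 = x.2 <;> by_cases h' : y.1 = y.2 <;> simp [h, h']
  have hsingle : ∀ m m' : Idx (solo a d), (Matrix.of fun i j =>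
      if i = m ∧ j = m' then (d : ℂ)⁻¹ else 0) = (d : ℂ)⁻¹ • Matrix.single m m' 1 := by
    intro m m'
    ext i j
    simp [Matrix.single_apply, eq_comm]
  have hrel : ∀ i j : Fin d, relabel (soloEquiv a d).symm (Matrix.single i j 1) =
      Matrix.single ((soloEquiv a d).symm i) ((soloEquiv a d).symm j) (1 : ℂ) := by
    intro i j
    ext x y
    simp [relabel_apply, Matrix.single_apply, Equiv.symm_apply_eq]
  rw [trace_mul_maxEntangled]
  simp only [sum_diagonal hab]
  simp only [entanglementSum, LinearMap.comp_apply,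
    relabel_apply (Equiv.piCongrRight (pairEquiv hab d)),
    relabel_apply (splitMul (solo b d) (solo a d)).total.symm, diagonalIdx,
    Equiv.symm_apply_apply, Equiv.symm_symm, Equiv.apply_symm_apply, ampliate_apply, hprep, hsingle,
    map_smul, Matrix.smul_apply, smul_eq_mul, ← Finset.mul_sum, relabel_apply (soloEquiv b d), hrel]
  field_simp

end Distillation

/-! ### Boundedness of the distillation fidelity -/

lemma IsCompletelyPositive.posSemidef {ι κ : Type} {Φ : OpMap ι κ} (h : IsCompletelyPositive Φ)
    {ρ : Matrix ι ι ℂ} (hρ : ρ.PosSemidef) : (Φ ρ).PosSemidef :=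
  (h.ampliate_posSemidef (hρ.submatrix (Prod.fst : ι × Unit → ι))).submatrix fun k => (k, ())

/-- Positivity of the quadratic form on the difference of two basis vectors. -/
lemma re_apply_le_of_posSemidef {ι : Type} [Fintype ι] {ρ : Matrix ι ι ℂ} (h : ρ.PosSemidef)
    (x y : ι) : (ρ x y).re ≤ ((ρ x x).re + (ρ y y).re) / 2 := by
  classical
  have h1 := h.re_dotProduct_nonneg (Pi.single x 1 - Pi.single y 1)
  have h2 : (ρ y x).re = (ρ x y).re := by
    rw [← h.isHermitian.apply y x]
    simp
  simp [Matrix.mulVec_sub, sub_dotProduct, dotProduct_sub] at h1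
  linarith

lemma re_apply_le_re_trace {ι : Type} [Fintype ι] {ρ : Matrix ι ι ℂ} (h : ρ.PosSemidef)
    (x y : ι) : (ρ x y).re ≤ ρ.trace.re := by
  have h0 : ∀ z, 0 ≤ (ρ z z).re := fun z => (Complex.nonneg_iff.mp h.diag_nonneg).1
  have h1 : ∀ z, (ρ z z).re ≤ ρ.trace.re := fun z => by
    rw [Matrix.trace, Complex.re_sum]
    exact Finset.single_le_sum (f := fun z => (ρ z z).re) (fun z _ => h0 z) (Finset.mem_univ z)
  linarith [re_apply_le_of_posSemidef h x y, h1 x, h1 y]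

section Main

variable {P : Type} [Fintype P] [DecidableEq P]

/-- A crude bound, from the entries of a density matrix having real part at most `1`. -/
lemma distillationFidelity_le {a b : P} (hab : a ≠ b) (d : ℕ+) (ρ : Op trivialSystem (pair a b d))
    (hρ : IsChannel ρ) : distillationFidelity ρ ≤ d := by
  have hd : (0 : ℝ) < d := by exact_mod_cast d.pos
  have h1 : (ρ 1).PosSemidef := hρ.1.posSemidef Matrix.PosSemidef.one
  have h2 : (ρ 1).trace.re = 1 := by
    have h0 : Fintype.card (Idx (trivialSystem (P := P))) = 1 :=
      Fintype.card_eq_one_iff.mpr ⟨fun _ => 0, fun _ => funext fun _ => eq_of_card_eq_one rfl _ _⟩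
    rw [hρ.2, Matrix.trace_one, h0]
    simp
  have h3 : distillationFidelity ρ =
      1 / (d : ℝ) * ∑ i, ∑ j, (ρ 1 (diagonalIdx hab d i) (diagonalIdx hab d j)).re := by
    have h4 : (1 / (d : ℂ)) = ((1 / (d : ℝ) : ℝ) : ℂ) := by push_cast; rfl
    rw [distillationFidelity, trace_mul_maxEntangled, h4, Complex.re_ofReal_mul]
    simp only [sum_diagonal hab, Complex.re_sum]
  have h5 : ∑ i, ∑ j, (ρ 1 (diagonalIdx hab d i) (diagonalIdx hab d j)).re ≤
      ∑ _i : Fin d, ∑ _j : Fin d, (1 : ℝ) :=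
    Finset.sum_le_sum fun i _ => Finset.sum_le_sum fun j _ => h2 ▸ re_apply_le_re_trace h1 _ _
  rw [h3, one_div, inv_mul_le_iff₀ hd]
  simpa using h5

/-! ### The two optimizations -/

variable {a b : P} {d : ℕ+} {c : ℕ} {S : OpClass P} {L : List (System P × System P)}

lemma add_div_mul_add_one_eq {d : ℕ+} (x y : ℝ) (h : x = (d : ℝ) ^ 2 * y) :
    ((d : ℝ) + x) / ((d : ℝ) * ((d : ℝ) + 1)) = ((d : ℝ) * y + 1) / ((d : ℝ) + 1) := by
  have hd : (0 : ℝ) < d := by exact_mod_cast d.pos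
  rw [h]
  field_simp
  ring

/-- Sending half of a locally prepared maximally entangled pair turns a transmission scheme into a
distillation scheme. -/
lemma exists_distillation (hab : a ≠ b) (hS : ∀ X Y : System P, ∀ Λ ∈ S X Y, IsChannel Λ)
    (hLOCC : ∀ X Y : System P, LOCC₁ a c X Y ⊆ S X Y) (E : NetworkProcess P L 1)
    (Θ : Manipulation S L (solo a d) (solo b d)) :
    ∃ Θ' : Manipulation S L trivialSystem (pair a b d), averageFidelity (Θ.apply E) =
      ((d : ℝ) * distillationFidelity (Θ'.apply E) + 1) / ((d : ℝ) + 1) := by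
  have h₁ := hLOCC _ _ (krausMap_prodMatrix_mem_LOCC₁ a c (prepareMatrix_isometry (solo a d)))
  have h₂ := hLOCC _ _ (krausMap_prodMatrix_mem_LOCC₁ a c fun q =>
    permMatrix_isometry (pairEquiv hab d q))
  refine ⟨.sandwich (solo a d) _ h₁ Θ _ h₂, ?_⟩
  have hd : (d : ℝ) ≠ 0 := by exact_mod_cast d.pos.ne'
  rw [averageFidelity_eq _ (Θ.isChannel_apply hS E)]
  refine add_div_mul_add_one_eq _ _ ?_
  have h3 : ((d : ℂ) ^ 2) = (((d : ℝ) ^ 2 : ℝ) : ℂ) := by push_cast; rfl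
  rw [distillationFidelity, Manipulation.sandwich_apply, krausMap_prodMatrix_permMatrix,
    trace_distilled hab, h3, Complex.div_ofReal_re]
  field_simp

/-- Teleportation through the distilled state turns a distillation scheme into a transmission
scheme. -/
lemma exists_transmission (hab : a ≠ b) (hc : (d : ℕ) ^ 2 ≤ 2 ^ c)
    (hS : ∀ X Y : System P, ∀ Λ ∈ S X Y, IsChannel Λ)
    (hLOCC : ∀ X Y : System P, LOCC₁ a c X Y ⊆ S X Y) (E : NetworkProcess P L 1)
    (Θ : Manipulation S L trivialSystem (pair a b d)) :
    ∃ Θ' : Manipulation S L (solo a d) (solo b d), averageFidelity (Θ'.apply E) =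
      ((d : ℝ) * distillationFidelity (Θ.apply E) + 1) / ((d : ℝ) + 1) := by
  have h₁ := hLOCC _ _ (krausMap_prodMatrix_mem_LOCC₁ a c fun q =>
    permMatrix_isometry (messageEquiv (solo a d) q))
  have h₂ := hLOCC _ _ (teleport_mem_LOCC₁ hab hc)
  refine ⟨.sandwich (solo a d) _ h₁ Θ _ h₂, ?_⟩
  rw [averageFidelity_eq _ (Manipulation.isChannel_apply hS _ E)]
  refine add_div_mul_add_one_eq _ _ ?_
  have h3 : ((d : ℂ) ^ 2) = (((d : ℝ) ^ 2 : ℝ) : ℂ) := by push_cast; rfl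
  rw [Manipulation.sandwich_apply, krausMap_prodMatrix_permMatrix, entanglementSum_teleport hab, h3,
    Complex.re_ofReal_mul]
  rfl

end Main

/-- Two families of reals whose values correspond under `x ↦ (d x + 1) / (d + 1)`: so do their
suprema, and one is attained if and only if the other one is. -/
lemma iSup_affine {α β : Type} [Nonempty α] [Nonempty β] {f : α → ℝ} {g : β → ℝ} {d : ℝ}
    (hd : 0 < d) (hg : BddAbove (Set.range g)) (h₁ : ∀ x, ∃ y, f x = (d * g y + 1) / (d + 1))
    (h₂ : ∀ y, ∃ x, f x = (d * g y + 1) / (d + 1)) :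
    BddAbove (Set.range f) ∧ ⨆ x, f x = (d * (⨆ y, g y) + 1) / (d + 1) ∧
      ((∃ x, f x = ⨆ x, f x) ↔ ∃ y, g y = ⨆ y, g y) := by
  have hle : ∀ x, f x ≤ (d * (⨆ y, g y) + 1) / (d + 1) := by
    intro x
    obtain ⟨y, hy⟩ := h₁ x
    rw [hy]
    gcongr
    exact le_ciSup hg y
  have hf : BddAbove (Set.range f) := ⟨_, Set.forall_mem_range.mpr hle⟩
  have heq : ⨆ x, f x = (d * (⨆ y, g y) + 1) / (d + 1) := by
    refine le_antisymm (ciSup_le hle) ?_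
    have h3 : ⨆ y, g y ≤ ((d + 1) * (⨆ x, f x) - 1) / d := by
      refine ciSup_le fun y => ?_
      obtain ⟨x, hx⟩ := h₂ y
      have h4 := le_ciSup hf x
      rw [hx, div_le_iff₀ (by positivity)] at h4
      rw [le_div_iff₀ hd]
      linarith
    rw [le_div_iff₀ hd] at h3
    rw [div_le_iff₀ (by positivity)]
    linarith
  have hinj : ∀ s t : ℝ, (d * s + 1) / (d + 1) = (d * t + 1) / (d + 1) ↔ s = t := by
    intro s t
    rw [div_left_inj' (by positivity), add_left_inj, mul_right_inj' hd.ne']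
  refine ⟨hf, heq, ?_, ?_⟩
  · rintro ⟨x, hx⟩
    obtain ⟨y, hy⟩ := h₁ x
    exact ⟨y, (hinj _ _).mp (by rw [← hy, hx, heq])⟩
  · rintro ⟨y, hy⟩
    obtain ⟨x, hx⟩ := h₂ y
    exact ⟨x, by rw [hx, heq, hy]⟩

end QuantumNetwork

end

theorem mainTheorem1 {P : Type} [Fintype P] [DecidableEq P] (a b : P) (hab : a ≠ b) (d : ℕ+)
    (poly : Polynomial ℕ) (hpoly : (d : ℕ) ^ 2 ≤ 2 ^ poly.eval (d : ℕ))
    (S : OpClass P)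
    (hS : ∀ X Y : System P, ∀ Λ ∈ S X Y, IsChannel Λ)
    (hLOCC : ∀ X Y : System P, LOCC₁ a (poly.eval (d : ℕ)) X Y ⊆ S X Y)
    (L : List (System P × System P)) (E : NetworkProcess P L 1) :
    (Nonempty (Manipulation S L (solo a d) (solo b d)) ∧
      ∀ Θ : Manipulation S L (solo a d) (solo b d), IsChannel (Θ.apply E)) ∧
    (Nonempty (Manipulation S L trivialSystem (pair a b d)) ∧
      ∀ Θ : Manipulation S L trivialSystem (pair a b d), IsChannel (Θ.apply E)) ∧
    BddAbove (Set.range fun Θ : Manipulation S L (solo a d) (solo b d) =>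
      averageFidelity (Θ.apply E)) ∧
    BddAbove (Set.range fun Θ : Manipulation S L trivialSystem (pair a b d) =>
      distillationFidelity (Θ.apply E)) ∧
    fMax S a b d E = ((d : ℝ) * FMax S a b d E + 1) / ((d : ℝ) + 1) ∧
    ((∃ Θ : Manipulation S L (solo a d) (solo b d),
        averageFidelity (Θ.apply E) = fMax S a b d E) ↔
      ∃ Θ : Manipulation S L trivialSystem (pair a b d),
        distillationFidelity (Θ.apply E) = FMax S a b d E) := by
  have hd : (0 : ℝ) < d := by exact_mod_cast d.pos
  have hprep : ∀ X Y : System P, localProduct (fun _ => discardPrepare 0) ∈ S X Y := fun X Y =>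
    hLOCC X Y (localProduct_mem_LOCC₁ a _ fun _ => isChannel_discardPrepare 0)
  have ht : Nonempty (Manipulation S L (solo a d) (solo b d)) := nonempty_manipulation hprep _ _ _
  have hs : Nonempty (Manipulation S L trivialSystem (pair a b d)) :=
    nonempty_manipulation hprep _ _ _
  have hbdd : BddAbove (Set.range fun Θ : Manipulation S L trivialSystem (pair a b d) =>
      distillationFidelity (Θ.apply E)) :=
    ⟨d, Set.forall_mem_range.mpr fun Θ =>
      distillationFidelity_le hab d _ (Θ.isChannel_apply hS E)⟩
  obtain ⟨h₁, h₂, h₃⟩ := iSup_affine hd hbdd (exists_distillation hab hS hLOCC E)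
    (exists_transmission hab hpoly hS hLOCC E)
  exact ⟨⟨ht, fun Θ => Θ.isChannel_apply hS E⟩, ⟨hs, fun Θ => Θ.isChannel_apply hS E⟩, h₁, hbdd,
    h₂, h₃⟩
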